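/- Let $K\ge 2$, let $\Delta_{K-1}=\{\theta\in\mathbb R^K:\ \sum_i\theta_i=1,\ \theta_i\ge 0\}$, let $\alpha\in(0,\infty)^K$, and let $\mathrm{Dir}_\alpha$ be the Dirichlet distribution on $\Delta_{K-1}$ with density proportional to $\prod_{i=1}^K\theta_i^{\alpha_i-1}$ (with respect to Lebesgue measure in the first $K-1$ coordinates). Let $H:\mathbb R^K\to\mathbb R$ and $\theta^*\in\Delta_{K-1}$ be such that (A1) $H(\theta)<H(\theta^*)$ for all $\theta\in\Delta_{K-1}\setminus\{\theta^*\}$; (A2) $H$ is continuous on $\Delta_{K-1}$ and twice continuously differentiable in an open neighborhood of $\theta^*$ in $\mathbb R^K$; and suppose that the number $m$ of zero components of $\theta^*$ satisfies $m\le K-2$, with the coordinates labelled so that $\theta^*_1=\dots=\theta^*_m=0<\theta^*_{m+1},\dots,\theta^*_K$. Let $\lambda_1,\dots,\lambda_m\ge 0$ be the KKT multipliers of the constraints $\theta_i\ge 0$, that is, $\nabla H(\theta^*)=-\sum_{i=1}^m\lambda_i e_i+\mu\mathbf 1_K$ for some $\mu\in\mathbb R$, and suppose (A3) $\lambda_i>0$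 for $i=1,\dots,m$; (A4) $d^\top\nabla^2H(\theta^*)d<0$ for all nonzero $d\in\mathbb R^K$ with $\mathbf 1_K^\top d=0$ and $d_i=0$ for $i\le m$. Let $\mathrm{KL}(\theta^*|\theta)=\sum_{k=1}^K\theta^*_k\log(\theta^*_k/\theta_k)\in[0,\infty]$ for $\theta\in\Delta_{K-1}$, where the terms with $\theta^*_k=0$ are $0$ (the same formula defines it for $\theta$ in a neighborhood of $\theta^*$ in $\mathbb R^K$), let $\widehat H(\theta)=H(\theta^*)-\mathrm{KL}(\theta^*|\theta)$, and for real $n>0$ let $$\rho_n=\frac{\mathrm{Cov}\big(e^{nH(\theta)},e^{n\widehat H(\theta)}\big)}{\sqrt{\mathrm{Var}\big(e^{nH(\theta)}\big)\,\mathrm{Var}\big(e^{n\widehat H(\theta)}\big)}},\qquad \theta\sim\mathrm{Dir}_\alpha,$$ with $e^{-\infty}=0$. Let $$U=\begin{pmatrix}0_{m\times(K-1-m)}\\ I_{K-1-m}\\ -\mathbf 1_{K-1-m}^\top\end{pmatrix},\qquad Q=U^\top\nabla^2H(\theta^*)U,\qquad R=-U^\top\nabla^2_\theta\mathrm{KL}(\theta^*|\theta)\big|_{\theta=\theta^*}U.$$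 Then, as $n\to\infty$, $$\rho_n^2\ \longrightarrow\ \frac{|\det Q|^{1/2}\,|\det R|^{1/2}}{\left|\det\left(\frac{Q+R}{2}\right)\right|}\ \prod_{k=1}^m\left(\frac{4\lambda_k}{(\lambda_k+1)^2}\right)^{\alpha_k}.$$ -/

import Mathlib

open MeasureTheory ProbabilityTheory Filter Topology

noncomputable section

/-- The projected simplex: `y` with nonnegative entries whose sum is at most `1`. -/
def projSimplex (K : ℕ) : Set (Fin (K - 1) → ℝ) :=
  {y | (∀ i, 0 ≤ y i) ∧ ∑ i, y i ≤ 1}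

/-- The identification `y ↦ (y₁, …, y_{K-1}, 1 - ∑ yᵢ)` of the projected simplex with the
simplex. -/
def liftSimplex (K : ℕ) (y : Fin (K - 1) → ℝ) : Fin K → ℝ :=
  fun i => if h : i.val < K - 1 then y ⟨i.val, h⟩ else 1 - ∑ j, y j

/-- The multivariate Beta function. -/
def multiBeta {K : ℕ} (α : Fin K → ℝ) : ℝ :=
  (∏ i, Real.Gamma (α i)) / Real.Gamma (∑ i, α i)

/-- The Dirichlet density `B(α)⁻¹ ∏ θᵢ ^ (αᵢ - 1)`. -/
def dirichletDensity {K : ℕ} (α θ : Fin K → ℝ) : ℝ :=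
  1 / multiBeta α * ∏ i, θ i ^ (α i - 1)

/-- The Dirichlet distribution: in the first `K - 1` coordinates it has the Dirichlet density
with respect to Lebesgue measure on the projected simplex. It is carried by the simplex. -/
def dirichletMeasure {K : ℕ} (α : Fin K → ℝ) : Measure (Fin K → ℝ) :=
  ((volume.restrict (projSimplex K)).withDensity
    (fun y => ENNReal.ofReal (dirichletDensity α (liftSimplex K y)))).map (liftSimplex K)

/-- The gradient, as the vector of partial derivatives. -/
def gradVec {K : ℕ} (f : (Fin K → ℝ) → ℝ) (x : Fin K → ℝ) : Fin K → ℝ :=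
  fun i => fderiv ℝ f x (Pi.single i 1)

/-- The Hessian matrix of second partial derivatives. -/
def hessMat {K : ℕ} (f : (Fin K → ℝ) → ℝ) (x : Fin K → ℝ) : Matrix (Fin K) (Fin K) ℝ :=
  Matrix.of fun i j => fderiv ℝ (fderiv ℝ f) x (Pi.single i 1) (Pi.single j 1)

/-- `θ` is the unique global maximizer of `H` on the simplex. -/
def IsUniqueSimplexMax {K : ℕ} (H : (Fin K → ℝ) → ℝ) (θ : Fin K → ℝ) : Prop :=
  θ ∈ stdSimplex ℝ (Fin K) ∧ ∀ x ∈ stdSimplex ℝ (Fin K), x ≠ θ → H x < H θ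

/-- `H` is continuous on the simplex and `C²` in an open neighbourhood of `θ` in `ℝ^K`. -/
def IsRegularAt {K : ℕ} (H : (Fin K → ℝ) → ℝ) (θ : Fin K → ℝ) : Prop :=
  ContinuousOn H (stdSimplex ℝ (Fin K)) ∧
    ∃ V : Set (Fin K → ℝ), IsOpen V ∧ θ ∈ V ∧ ContDiffOn ℝ 2 H V

/-- `lam` is the vector of KKT multipliers of the constraints `θᵢ ≥ 0` in the maximization of `H`
over the simplex, at the point `θ` (zero at the inactive constraints). -/
def IsKKTMultiplier {K : ℕ} (H : (Fin K → ℝ) → ℝ) (θ lam : Fin K → ℝ) : Prop :=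
  (∀ i, 0 ≤ lam i) ∧ (∀ i, lam i * θ i = 0) ∧ ∃ μ : ℝ, ∀ i, gradVec H θ i = -lam i + μ

/-- The critical cone at `θ`: directions of zero sum that vanish at the zero components of `θ`. -/
def criticalCone {K : ℕ} (θ : Fin K → ℝ) : Set (Fin K → ℝ) :=
  {d | ∑ i, d i = 0 ∧ ∀ i, θ i = 0 → d i = 0}

/-- The Hessian of `H` at `θ` is negative definite on the critical cone. -/
def IsNegDefOnCriticalCone {K : ℕ} (H : (Fin K → ℝ) → ℝ) (θ : Fin K → ℝ) : Prop :=
  ∀ d ∈ criticalCone θ, d ≠ 0 → dotProduct d ((hessMat H θ).mulVec d) < 0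

open Classical in
/-- The Kullback-Leibler divergence `∑ pᵢ log (pᵢ / qᵢ)` of `p` (a probability vector) from `q`,
with terms `pᵢ = 0` counted as `0`, and the value `+∞` if `qᵢ ≤ 0 ≠ pᵢ` for some `i`. -/
def klVec {K : ℕ} (p q : Fin K → ℝ) : EReal :=
  if ∃ i, p i ≠ 0 ∧ q i ≤ 0 then ⊤ else ((∑ i, p i * Real.log (p i / q i) : ℝ) : EReal)

/-- The function `Ĥ = H(θ*) - KL(θ* | ·)`, with value `-∞` where the divergence is infinite. -/
def hatH {K : ℕ} (H : (Fin K → ℝ) → ℝ) (θs : Fin K → ℝ) (θ : Fin K → ℝ) : EReal :=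
  (H θs : EReal) - klVec θs θ

/-- The quantity of interest `e^{n H}`. -/
def target {K : ℕ} (H : (Fin K → ℝ) → ℝ) (n : ℝ) (θ : Fin K → ℝ) : ℝ :=
  Real.exp (n * H θ)

/-- The control variate `e^{n Ĥ}`, where `e^{-∞} = 0`. -/
def controlVariate {K : ℕ} (H : (Fin K → ℝ) → ℝ) (θs : Fin K → ℝ) (n : ℝ) (θ : Fin K → ℝ) : ℝ :=
  (EReal.exp ((n : EReal) * hatH H θs θ)).toReal

/-- The correlation of two real random variables. -/
def correlation {Ω : Type*} [MeasurableSpace Ω] (X Y : Ω → ℝ) (μ : Measure Ω) : ℝ :=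
  covariance X Y μ / Real.sqrt (variance X μ * variance Y μ)

/-- The correlation `ρₙ` of `e^{n H}` and `e^{n Ĥ}` under the Dirichlet distribution. -/
def rhoCV {K : ℕ} (α : Fin K → ℝ) (H : (Fin K → ℝ) → ℝ) (θs : Fin K → ℝ) (n : ℝ) : ℝ :=
  correlation (target H n) (controlVariate H θs n) (dirichletMeasure α)

/-- The `K × (K-1-m)` matrix with blocks `0` (`m` rows), the identity, and a last row of `-1`;
its columns are a basis of the critical cone when exactly the first `m` components vanish. -/
def basisU (K m : ℕ) : Matrix (Fin K) (Fin (K - 1 - m)) ℝ :=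
  Matrix.of fun i j =>
    if i.val = m + j.val then 1 else if i.val = K - 1 then -1 else 0

/-- The reduced Hessian `Uᵀ ∇²H(θ*) U`. -/
def reducedQ {K : ℕ} (m : ℕ) (H : (Fin K → ℝ) → ℝ) (θs : Fin K → ℝ) :
    Matrix (Fin (K - 1 - m)) (Fin (K - 1 - m)) ℝ :=
  (basisU K m).transpose * hessMat H θs * basisU K m

/-- The reduced Hessian `-Uᵀ ∇²KL(θ* | θ)|_{θ = θ*} U`. -/
def reducedR {K : ℕ} (m : ℕ) (θs : Fin K → ℝ) :
    Matrix (Fin (K - 1 - m)) (Fin (K - 1 - m)) ℝ :=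
  -((basisU K m).transpose * hessMat (fun θ => (klVec θs θ).toReal) θs * basisU K m)

end

set_option linter.unusedSectionVars false

/-! Correlation is unchanged when both variables are divided by $e^{nH(\theta^*)}$. It then concerns
$G^n$ and $L^n$ with $G=e^{H-H(\theta^*)}$ and $L=e^{-\mathrm{KL}(\theta^*|\cdot)}$, two functions
on the simplex with values in $[0,1]$ that attain $1$ only at $\theta^*$. Phases are handled as such
functions rather than as their logarithms because $L$ vanishes, continuously, where the divergence
is infinite.

The squared correlation is a quotient of three covariances. Each has the form $E[(PP')^n]$ minus a
constant times $E[P^n]E[P'^n]$, with $P,P'\in\{G,L\}$. Laplace's method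
(`IsLaplacePhase.tendsto_setIntegral`) shows that every such expectation has order $n^{-\tau}$,
where $\tau=\sum_{k\le m}\alpha_k+(K-1-m)/2$: a boundary coordinate scales like $1/n$ and
contributes $\alpha_k$ through the Dirichlet weight, an interior one scales like $1/\sqrt n$ and
contributes $1/2$. As $\tau>0$, the product of means is negligible and only the mixed moment
survives (`tendsto_covariance_dirichletMeasure`).

At leading order the phase is linear in the boundary coordinates, with the KKT multipliers as
slopes, and quadratic in the interior ones, with the reduced Hessian as matrix
(`expansion_liftSimplex`). The limiting integral is therefore a product of Gamma integrals and a
Gaussian integral (`laplaceLimit_boundaryPhase`). For $-\mathrm{KL}$ all boundary multipliers equal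
$1$ (`gradVec_negKL`). Leading phases add under multiplication of $P$ and $P'$, so the three moments
carry slopes $\lambda_k+1$, $2\lambda_k$, $2$ and matrices $-(Q+R)$, $-2Q$, $-2R$. In the quotient
the powers of $n$, the regular part of the density at $\theta^*$, the Gamma values and the powers of
$2\pi$ cancel. What remains is $\prod_k(4\lambda_k/(\lambda_k+1)^2)^{\alpha_k}$ times the ratio of
determinants. -/

/-- Linear change of variables on `ι → ℝ`. -/
theorem integral_comp_mulVec {ι : Type*} [Fintype ι] [DecidableEq ι] (M : Matrix ι ι ℝ)
    (hM : M.det ≠ 0) (f : (ι → ℝ) → ℝ) :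
    ∫ x, f (M.mulVec x) = |M.det|⁻¹ * ∫ x, f x := by
  have hmap := Real.map_matrix_volume_pi_eq_smul_volume_pi hM
  have hemb : MeasurableEmbedding (Matrix.toLin' M) := by
    have hdet : LinearMap.det (Matrix.toLin' M) ≠ 0 := by rwa [LinearMap.det_toLin']
    exact (LinearEquiv.ofIsUnitDet (f := Matrix.toLin' M) (v := Pi.basisFun ℝ ι)
      (v' := Pi.basisFun ℝ ι) (by
        rw [LinearMap.toMatrix_eq_toMatrix', LinearMap.toMatrix'_toLin']
        exact hM.isUnit)).toContinuousLinearEquiv.toHomeomorph.measurableEmbedding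
  have h := hemb.integral_map (μ := volume) f
  rw [hmap, integral_smul_measure, ENNReal.toReal_ofReal (abs_nonneg _), smul_eq_mul, abs_inv] at h
  simpa [Matrix.toLin'_apply] using h.symm

/-! ### Anisotropic dilations, gauges and phases -/

section Laplace

variable {ι : Type*} [Fintype ι] (b : ι → Prop) [DecidablePred b]

/-- The vectors whose coordinates selected by `b` are nonnegative. -/
def partialOrthant (b : ι → Prop) : Set (ι → ℝ) := {x | ∀ i, b i → 0 ≤ x i}

/-- The anisotropic gauge: linear in the coordinates selected by `b`, quadratic in the others. -/
noncomputable def anisoGauge (x : ι → ℝ) : ℝ := ∑ i, if b i then |x i| else x i ^ 2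

/-- The anisotropic scaling factors. -/
noncomputable def anisoFactor (n : ℝ) (i : ι) : ℝ := if b i then n⁻¹ else (Real.sqrt n)⁻¹

/-- The anisotropic dilation. -/
noncomputable def anisoScale (n : ℝ) (x : ι → ℝ) : ι → ℝ := fun i => anisoFactor b n i * x i

/-- The weight `∏ xᵢ ^ (aᵢ - 1)` over the coordinates selected by `b`. -/
noncomputable def boundaryWeight (a x : ι → ℝ) : ℝ := ∏ i, if b i then x i ^ (a i - 1) else 1

/-- The exponent of decay of Laplace integrals. -/
noncomputable def laplaceExponent (a : ι → ℝ) : ℝ := ∑ i, if b i then a i else 1 / 2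

/-- The limit of rescaled Laplace integrals with leading phase `ℓ`. -/
noncomputable def laplaceLimit (a : ι → ℝ) (ℓ : (ι → ℝ) → ℝ) : ℝ :=
  ∫ x in partialOrthant b, Real.exp (ℓ x) * boundaryWeight b a x

/-- `ℓ` is quasi-homogeneous for the anisotropic dilations, and coercive on the orthant. -/
structure IsLeadingPhase (ℓ : (ι → ℝ) → ℝ) : Prop where
  continuous : Continuous ℓ
  homogeneous : ∀ n : ℝ, 0 < n → ∀ x, ℓ (anisoScale b n x) = n⁻¹ * ℓ x
  coercive : ∃ c > 0, ∀ x ∈ partialOrthant b, ℓ x ≤ -c * anisoGauge b x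

/-- `P` has on `S` a strict global maximum `1` at `0`, with leading phase `ℓ` there. -/
structure IsLaplacePhase (S : Set (ι → ℝ)) (P ℓ : (ι → ℝ) → ℝ) : Prop where
  continuousOn : ContinuousOn P S
  nonneg : ∀ x ∈ S, 0 ≤ P x
  le_one : ∀ x ∈ S, P x ≤ 1
  far : ∀ U ∈ 𝓝 (0 : ι → ℝ), ∃ η < 1, ∀ x ∈ S \ U, P x ≤ η
  pos : ∀ᶠ x in 𝓝[S] 0, 0 < P x
  expansion : (fun x => Real.log (P x) - ℓ x) =o[𝓝[S] 0] anisoGauge b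
  leading : IsLeadingPhase b ℓ

variable {b}

theorem IsLeadingPhase.add {ℓ ℓ' : (ι → ℝ) → ℝ} (h : IsLeadingPhase b ℓ)
    (h' : IsLeadingPhase b ℓ') : IsLeadingPhase b (fun x => ℓ x + ℓ' x) := by
  refine ⟨h.continuous.add h'.continuous, fun n hn x => ?_, ?_⟩
  · rw [h.homogeneous n hn, h'.homogeneous n hn]; ring
  · obtain ⟨c, hc, h1⟩ := h.coercive
    obtain ⟨c', hc', h2⟩ := h'.coercive
    refine ⟨c + c', by positivity, fun x hx => ?_⟩
    have := h1 x hx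
    have := h2 x hx
    linarith

/-- This turns a mixed moment of two phases into a single Laplace integral. Away from the origin the
bound on one factor suffices, as the other is at most $1$. -/
theorem IsLaplacePhase.mul {S : Set (ι → ℝ)} {P P' ℓ ℓ' : (ι → ℝ) → ℝ}
    (h : IsLaplacePhase b S P ℓ) (h' : IsLaplacePhase b S P' ℓ') :
    IsLaplacePhase b S (fun x => P x * P' x) (fun x => ℓ x + ℓ' x) where
  continuousOn := h.continuousOn.mul h'.continuousOn
  nonneg x hx := mul_nonneg (h.nonneg x hx) (h'.nonneg x hx)
  le_one x hx := mul_le_one₀ (h.le_one x hx) (h'.nonneg x hx) (h'.le_one x hx)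
  far U hU := by
    obtain ⟨η, hη, h1⟩ := h.far U hU
    exact ⟨η, hη, fun x hx =>
      (mul_le_of_le_one_right (h.nonneg x hx.1) (h'.le_one x hx.1)).trans (h1 x hx)⟩
  pos := by
    filter_upwards [h.pos, h'.pos] with x h1 h2 using mul_pos h1 h2
  expansion := by
    refine (h.expansion.add h'.expansion).congr' ?_ EventuallyEq.rfl
    filter_upwards [h.pos, h'.pos] with x h1 h2
    rw [Real.log_mul h1.ne' h2.ne']; ring
  leading := h.leading.add h'.leading

theorem anisoFactor_pos {n : ℝ} (hn : 0 < n) (i : ι) : 0 < anisoFactor b n i := by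
  unfold anisoFactor; split_ifs <;> positivity

theorem anisoScale_mem_partialOrthant {n : ℝ} (hn : 0 < n) {x : ι → ℝ} :
    anisoScale b n x ∈ partialOrthant b ↔ x ∈ partialOrthant b := by
  refine forall₂_congr fun i _ => ?_
  exact mul_nonneg_iff_of_pos_left (anisoFactor_pos hn i)

theorem anisoGauge_nonneg (x : ι → ℝ) : 0 ≤ anisoGauge b x :=
  Finset.sum_nonneg fun i _ => by split_ifs <;> positivity

theorem anisoGauge_anisoScale {n : ℝ} (hn : 0 < n) (x : ι → ℝ) :
    anisoGauge b (anisoScale b n x) = n⁻¹ * anisoGauge b x := by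
  unfold anisoGauge anisoScale anisoFactor
  rw [Finset.mul_sum]
  refine Finset.sum_congr rfl fun i _ => ?_
  split_ifs
  · rw [abs_mul, abs_of_pos (inv_pos.2 hn)]
  · rw [mul_pow, inv_pow, Real.sq_sqrt hn.le]

theorem tendsto_anisoScale (x : ι → ℝ) :
    Tendsto (fun n : ℝ => anisoScale b n x) atTop (𝓝 0) := by
  rw [tendsto_pi_nhds]
  intro i
  have : Tendsto (fun n : ℝ => anisoFactor b n i) atTop (𝓝 0) := by
    unfold anisoFactor
    split_ifs
    · exact tendsto_inv_atTop_zero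
    · exact tendsto_inv_atTop_zero.comp Real.tendsto_sqrt_atTop
  simpa [anisoScale] using this.mul_const (x i)

theorem measurableSet_partialOrthant : MeasurableSet (partialOrthant b) := by
  have : partialOrthant b = ⋂ i, ⋂ (_ : b i), {x | 0 ≤ x i} := by
    ext x; simp [partialOrthant]
  rw [this]
  exact MeasurableSet.iInter fun i => MeasurableSet.iInter fun _ =>
    measurableSet_le measurable_const (measurable_pi_apply i)

theorem measurable_boundaryWeight (a : ι → ℝ) : Measurable (boundaryWeight b a) := by
  unfold boundaryWeight
  refine Finset.measurable_prod _ fun i _ => ?_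
  split_ifs
  · exact (measurable_pi_apply i).pow_const _
  · exact measurable_const

theorem boundaryWeight_nonneg (a : ι → ℝ) {x : ι → ℝ} (hx : x ∈ partialOrthant b) :
    0 ≤ boundaryWeight b a x := by
  refine Finset.prod_nonneg fun i _ => ?_
  split_ifs with h
  · exact Real.rpow_nonneg (hx i h) _
  · exact zero_le_one

/-- The Jacobian, the weight and the normalization of a Laplace integral balance under the
anisotropic dilation. -/
theorem rpow_laplaceExponent_mul_boundaryWeight (a : ι → ℝ) {n : ℝ} (hn : 0 < n) {x : ι → ℝ}
    (hx : x ∈ partialOrthant b) :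
    n ^ laplaceExponent b a * ((∏ i, anisoFactor b n i) * boundaryWeight b a (anisoScale b n x))
      = boundaryWeight b a x := by
  unfold laplaceExponent boundaryWeight
  rw [Real.rpow_sum_of_pos hn, ← Finset.prod_mul_distrib, ← Finset.prod_mul_distrib]
  refine Finset.prod_congr rfl fun i _ => ?_
  unfold anisoScale anisoFactor
  split_ifs with h
  · rw [Real.mul_rpow (inv_nonneg.2 hn.le) (hx i h), Real.inv_rpow hn.le, Real.rpow_sub_one hn.ne']
    have : n ^ a i ≠ 0 := (Real.rpow_pos_of_pos hn _).ne'
    field_simp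
  · rw [← Real.sqrt_eq_rpow, mul_one, mul_inv_cancel₀ (Real.sqrt_pos.2 hn).ne']

/-- The weighted exponential of the gauge is integrable over the orthant. -/
theorem integrable_exp_anisoGauge_mul_boundaryWeight {a : ι → ℝ} (ha : ∀ i, b i → 0 < a i)
    {c : ℝ} (hc : 0 < c) :
    IntegrableOn (fun x => Real.exp (-c * anisoGauge b x) * boundaryWeight b a x)
      (partialOrthant b) := by
  let k : ι → ℝ → ℝ := fun i t => if b i then
    (Set.Ioi (0 : ℝ)).indicator (fun t => t ^ (a i - 1) * Real.exp (-(c * t))) t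
    else Real.exp (-c * t ^ 2)
  have hk : ∀ i, Integrable (k i) := by
    intro i
    by_cases h : b i
    · simp only [k, h, if_true]
      rw [integrable_indicator_iff measurableSet_Ioi]
      -- Integrability is read off the closed form: the integral of a non-integrable function is $0$
      -- by convention, but the Gamma value is positive.
      have := Real.integral_rpow_mul_exp_neg_mul_Ioi (ha i h) hc
      by_contra hni
      rw [integral_undef hni] at this
      have h2 : 0 < (1 / c) ^ a i * Real.Gamma (a i) :=
        mul_pos (Real.rpow_pos_of_pos (by positivity) _) (Real.Gamma_pos_of_pos (ha i h))
      exact h2.ne this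
    · simp only [k, h, if_false]
      exact integrable_exp_neg_mul_sq hc
  have hprod : Integrable (fun x : ι → ℝ => ∏ i, k i (x i)) := Integrable.fintype_prod hk
  rw [← integrable_indicator_iff measurableSet_partialOrthant]
  refine hprod.congr ?_
  -- The one-dimensional factors live on the open half-line and the orthant is closed; the
  -- difference lies in coordinate hyperplanes, which are null.
  have hae : ∀ᵐ x : ι → ℝ, ∀ i, x i ≠ 0 := by
    rw [ae_all_iff]
    intro i
    have := Measure.pi_hyperplane (fun _ : ι => (volume : Measure ℝ)) i 0
    rw [ae_iff]
    simpa [volume_pi] using this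
  filter_upwards [hae] with x hx0
  by_cases hx : x ∈ partialOrthant b
  · rw [Set.indicator_of_mem hx]
    unfold anisoGauge boundaryWeight
    rw [Finset.mul_sum, Real.exp_sum, ← Finset.prod_mul_distrib]
    refine Finset.prod_congr rfl fun i _ => ?_
    by_cases h : b i
    · have hpos : 0 < x i := lt_of_le_of_ne (hx i h) (hx0 i).symm
      simp only [k, h, if_true, Set.indicator_of_mem (Set.mem_Ioi.2 hpos), abs_of_pos hpos]
      ring_nf
    · simp [k, h]
  · rw [Set.indicator_of_notMem hx]
    simp only [partialOrthant, Set.mem_ofPred_eq, not_forall, not_le] at hx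
    obtain ⟨i, hi, hxi⟩ := hx
    refine Finset.prod_eq_zero (Finset.mem_univ i) ?_
    simp only [k, hi, if_true]
    exact Set.indicator_of_notMem (by simpa using hxi.le) _

theorem integral_comp_anisoScale {n : ℝ} (hn : 0 < n) (f : (ι → ℝ) → ℝ) :
    ∫ x, f x = (∏ i, anisoFactor b n i) * ∫ x, f (anisoScale b n x) := by
  classical
  have hpos : 0 < ∏ i, anisoFactor b n i := Finset.prod_pos fun i _ => anisoFactor_pos hn i
  have hdet : (Matrix.diagonal (anisoFactor b n)).det = ∏ i, anisoFactor b n i :=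
    Matrix.det_diagonal
  have h := integral_comp_mulVec (Matrix.diagonal (anisoFactor b n)) (by rw [hdet]; exact hpos.ne') f
  rw [hdet, abs_of_pos hpos] at h
  have h2 : ∀ x, (Matrix.diagonal (anisoFactor b n)).mulVec x = anisoScale b n x := by
    intro x; ext i; simp [Matrix.mulVec_diagonal, anisoScale]
  simp only [h2] at h
  rw [h, mul_inv_cancel_left₀ hpos.ne']

theorem tendsto_rpow_mul_rpow_atTop {η : ℝ} (h0 : 0 < η) (h1 : η < 1) (s : ℝ) :
    Tendsto (fun n : ℝ => n ^ s * η ^ n) atTop (𝓝 0) := by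
  have := tendsto_rpow_mul_exp_neg_mul_atTop_nhds_zero s (-Real.log η)
    (neg_pos.2 (Real.log_neg h0 h1))
  refine this.congr fun n => ?_
  rw [Real.rpow_def_of_pos h0]; ring_nf

end Laplace

/-! ### Laplace's method at a boundary maximum -/

section Laplace
variable {ι : Type*} [Fintype ι] {b : ι → Prop} [DecidablePred b]

/-- The part of a Laplace integral away from the maximum is negligible. -/
theorem IsLaplacePhase.tendsto_setIntegral_diff {S : Set (ι → ℝ)} {P ℓ : (ι → ℝ) → ℝ}
    (h : IsLaplacePhase b S P ℓ) (hS : MeasurableSet S) {w : (ι → ℝ) → ℝ}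
    (hw : IntegrableOn w S) {U : Set (ι → ℝ)} (hUo : IsOpen U) (hU : (0 : ι → ℝ) ∈ U) (s : ℝ) :
    Tendsto (fun n : ℝ => n ^ s * ∫ x in S \ U, P x ^ n * w x) atTop (𝓝 0) := by
  obtain ⟨η, hη1, hη⟩ := h.far U (hUo.mem_nhds hU)
  -- `η` may be nonpositive, for instance when `S \ U` is empty; the decay of `η' ^ n` needs a base
  -- in $(0,1)$.
  set η' := max η (1 / 2) with hη'
  have h0 : 0 < η' := lt_max_of_lt_right (by norm_num)
  have h1 : η' < 1 := max_lt hη1 (by norm_num)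
  have key := (tendsto_rpow_mul_rpow_atTop h0 h1 s).mul_const (∫ x in S \ U, |w x|)
  rw [zero_mul] at key
  refine squeeze_zero_norm' ?_ key
  filter_upwards [eventually_gt_atTop 0] with n hn
  have hmeas : MeasurableSet (S \ U) := hS.diff hUo.measurableSet
  rw [norm_mul, Real.norm_of_nonneg (Real.rpow_nonneg hn.le s), mul_assoc]
  refine mul_le_mul_of_nonneg_left ?_ (Real.rpow_nonneg hn.le s)
  rw [← integral_const_mul]
  refine norm_integral_le_of_norm_le (((hw.mono_set Set.sdiff_subset).abs).const_mul _) ?_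
  filter_upwards [ae_restrict_mem hmeas] with x hx
  have hPx := h.nonneg x hx.1
  rw [norm_mul, Real.norm_of_nonneg (Real.rpow_nonneg hPx n), Real.norm_eq_abs]
  gcongr
  exact (hη x hx).trans (le_max_left _ _)

/-- **Laplace's method** at a boundary maximum: with a weight `∏ xᵢ ^ (aᵢ - 1)` and a phase that is
to leading order linear in the boundary coordinates and quadratic in the others. -/
theorem IsLaplacePhase.tendsto_setIntegral {S : Set (ι → ℝ)} {P ℓ : (ι → ℝ) → ℝ}
    (h : IsLaplacePhase b S P ℓ) (hS : MeasurableSet S) (hSsub : S ⊆ partialOrthant b)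
    (hSnear : ∀ᶠ x in 𝓝[partialOrthant b] 0, x ∈ S)
    {a : ι → ℝ} (ha : ∀ i, b i → 0 < a i) {g : (ι → ℝ) → ℝ} (hgm : Measurable g)
    (hg : ContinuousAt g 0) (hint : IntegrableOn (fun x => boundaryWeight b a x * g x) S) :
    Tendsto (fun n : ℝ => n ^ laplaceExponent b a *
        ∫ x in S, P x ^ n * (boundaryWeight b a x * g x)) atTop
      (𝓝 (g 0 * laplaceLimit b a ℓ)) := by
  obtain ⟨c, hc, hcoer⟩ := h.leading.coercive
  -- The remainder is made at most half of the coercive decay `c`, so the other half still dominates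
  -- the rescaled integrand by an integrable function independent of `n`.
  have hgood : ∀ᶠ x in 𝓝[partialOrthant b] 0, x ∈ S ∧ 0 < P x ∧
      |Real.log (P x) - ℓ x| ≤ c / 2 * anisoGauge b x ∧ |g x| ≤ |g 0| + 1 := by
    have e1 := h.pos
    have e2 := h.expansion.bound (half_pos hc)
    rw [eventually_nhdsWithin_iff] at e1 e2 hSnear
    have e3 : ∀ᶠ x in 𝓝 (0 : ι → ℝ), |g x| ≤ |g 0| + 1 :=
      (hg.abs.eventually (Iio_mem_nhds (lt_add_one |g 0|))).mono fun x hx => le_of_lt hx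
    rw [eventually_nhdsWithin_iff]
    filter_upwards [e1, e2, e3, hSnear] with x h1 h2 h3 h4 hx
    refine ⟨h4 hx, h1 (h4 hx), ?_, h3⟩
    have := h2 (h4 hx)
    rwa [Real.norm_eq_abs, Real.norm_of_nonneg (anisoGauge_nonneg x)] at this
  obtain ⟨U, hUo, h0U, hU⟩ := mem_nhdsWithin.1 hgood
  have hUS : S ∩ U = U ∩ partialOrthant b := by
    ext x
    exact ⟨fun hx => ⟨hx.2, hSsub hx.1⟩, fun hx => ⟨(hU hx).1, hx.1⟩⟩
  have hmUS : MeasurableSet (S ∩ U) := hS.inter hUo.measurableSet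
  have hOm : MeasurableSet (partialOrthant b) := measurableSet_partialOrthant
  set w := boundaryWeight b a with hw
  have hwm : Measurable w := measurable_boundaryWeight a
  -- the localized integrand
  let f : ℝ → (ι → ℝ) → ℝ := fun n => (S ∩ U).indicator fun x => P x ^ n * (w x * g x)
  -- `P` is controlled only on `S`, so measurability is obtained for its truncation.
  have hPm : Measurable ((S ∩ U).indicator P) := by
    classical
    rw [← Set.piecewise_eq_indicator]
    exact (h.continuousOn.mono Set.inter_subset_left).measurable_piecewise continuousOn_const hmUS
  have hfm : ∀ n, Measurable (f n) := by
    intro n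
    have : f n = (S ∩ U).indicator
        (fun x => (S ∩ U).indicator P x ^ n * (w x * g x)) := by
      ext x
      by_cases hx : x ∈ S ∩ U
      · simp only [f, Set.indicator_of_mem hx]
      · simp only [f, Set.indicator_of_notMem hx]
    rw [this]
    exact ((hPm.pow_const n).mul (hwm.mul hgm)).indicator hmUS
  -- The localized integrand after the dilation, with Jacobian and normalization included. Its
  -- support exhausts the orthant as `n` grows.
  let φ : ℝ → (ι → ℝ) → ℝ := fun n x =>
    n ^ laplaceExponent b a * ((∏ i, anisoFactor b n i) * f n (anisoScale b n x))
  have hφ : ∀ n, 0 < n → ∀ x, φ n x = (partialOrthant b).indicator (fun x =>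
      (anisoScale b n ⁻¹' U).indicator (fun x =>
        P (anisoScale b n x) ^ n * g (anisoScale b n x) * w x) x) x := by
    intro n hn x
    by_cases hx : x ∈ partialOrthant b
    · rw [Set.indicator_of_mem hx]
      by_cases hxU : anisoScale b n x ∈ U
      · have hmem : anisoScale b n x ∈ S ∩ U := by
          rw [hUS]; exact ⟨hxU, (anisoScale_mem_partialOrthant hn).2 hx⟩
        rw [Set.indicator_of_mem (show x ∈ anisoScale b n ⁻¹' U from hxU)]
        simp only [φ, f, Set.indicator_of_mem hmem]
        rw [hw, ← rpow_laplaceExponent_mul_boundaryWeight a hn hx]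
        ring
      · rw [Set.indicator_of_notMem (show x ∉ anisoScale b n ⁻¹' U from hxU)]
        simp only [φ, f, Set.indicator_of_notMem (fun hm : _ ∈ S ∩ U => hxU hm.2), mul_zero]
    · rw [Set.indicator_of_notMem hx]
      have : anisoScale b n x ∉ S ∩ U := fun hm =>
        hx ((anisoScale_mem_partialOrthant hn).1 (hSsub hm.1))
      simp only [φ, f, Set.indicator_of_notMem this, mul_zero]
  have hPn : ∀ n, 0 < n → ∀ x ∈ partialOrthant b, anisoScale b n x ∈ U →
      P (anisoScale b n x) ^ n =
        Real.exp (ℓ x + n * (Real.log (P (anisoScale b n x)) - ℓ (anisoScale b n x))) := by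
    intro n hn x hx hxU
    have := hU ⟨hxU, (anisoScale_mem_partialOrthant hn).2 hx⟩
    rw [Real.rpow_def_of_pos this.2.1, h.leading.homogeneous n hn]
    congr 1
    field_simp
    ring
  have hlim : Tendsto (fun n => ∫ x, φ n x) atTop
      (𝓝 (∫ x, (partialOrthant b).indicator (fun x => Real.exp (ℓ x) * g 0 * w x) x)) := by
    refine tendsto_integral_filter_of_dominated_convergence
      ((partialOrthant b).indicator fun x =>
        (|g 0| + 1) * (Real.exp (-(c / 2) * anisoGauge b x) * w x)) ?_ ?_ ?_ ?_
    · filter_upwards with n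
      have hsm : Measurable (anisoScale (ι := ι) b n) :=
        measurable_pi_iff.2 fun i => (measurable_pi_apply i).const_mul _
      exact ((((hfm n).comp hsm).const_mul _).const_mul _).aestronglyMeasurable
    · filter_upwards [eventually_gt_atTop 0] with n hn
      refine ae_of_all _ fun x => ?_
      rw [hφ n hn]
      by_cases hx : x ∈ partialOrthant b
      · rw [Set.indicator_of_mem hx, Set.indicator_of_mem hx]
        have hw0 : 0 ≤ w x := boundaryWeight_nonneg a hx
        by_cases hxU : anisoScale b n x ∈ U
        · rw [Set.indicator_of_mem (show x ∈ anisoScale b n ⁻¹' U from hxU), hPn n hn x hx hxU,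
            norm_mul, norm_mul, Real.norm_of_nonneg hw0, Real.norm_of_nonneg (Real.exp_nonneg _)]
          obtain ⟨-, -, h3, h4⟩ := hU ⟨hxU, (anisoScale_mem_partialOrthant hn).2 hx⟩
          have hexp : ℓ x + n * (Real.log (P (anisoScale b n x)) - ℓ (anisoScale b n x))
              ≤ -(c / 2) * anisoGauge b x := by
            have h5 := hcoer x hx
            rw [anisoGauge_anisoScale hn] at h3
            have h6 := mul_le_mul_of_nonneg_left ((le_abs_self _).trans h3) hn.le
            have h7 : n * (c / 2 * (n⁻¹ * anisoGauge b x)) = c / 2 * anisoGauge b x := by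
              field_simp
            rw [h7] at h6
            linarith
          calc _ ≤ Real.exp (-(c / 2) * anisoGauge b x) * (|g 0| + 1) * w x := by
                gcongr
                exact h4
            _ = _ := by ring
        · rw [Set.indicator_of_notMem (show x ∉ anisoScale b n ⁻¹' U from hxU), norm_zero]
          positivity
      · rw [Set.indicator_of_notMem hx, Set.indicator_of_notMem hx, norm_zero]
    · rw [integrable_indicator_iff hOm]
      exact (integrable_exp_anisoGauge_mul_boundaryWeight ha (half_pos hc)).const_mul _
    · refine ae_of_all _ fun x => ?_
      by_cases hx : x ∈ partialOrthant b
      · rw [Set.indicator_of_mem hx]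
        have hsc := tendsto_anisoScale (b := b) x
        have hscU : ∀ᶠ n in atTop, anisoScale b n x ∈ U := hsc.eventually (hUo.mem_nhds h0U)
        have hscS : Tendsto (fun n : ℝ => anisoScale b n x) atTop (𝓝[S] 0) := by
          refine tendsto_nhdsWithin_iff.2 ⟨hsc, ?_⟩
          filter_upwards [hscU, eventually_gt_atTop 0] with n h1 hn
          exact (hU ⟨h1, (anisoScale_mem_partialOrthant hn).2 hx⟩).1
        -- The gauge of the dilated point is $n^{-1}$ times that of `x`, so a remainder that is
        -- little-o of the gauge vanishes even after multiplication by `n`.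
        have hrem : Tendsto (fun n : ℝ =>
            n * (Real.log (P (anisoScale b n x)) - ℓ (anisoScale b n x))) atTop (𝓝 0) := by
          have h1 := h.expansion.comp_tendsto hscS
          have h2 := (Asymptotics.isBigO_refl (fun n : ℝ => n) atTop).mul_isLittleO h1
          have h3 : (fun n : ℝ => n * (anisoGauge b ∘ fun n : ℝ => anisoScale b n x) n)
              =ᶠ[atTop] fun _ => anisoGauge b x := by
            filter_upwards [eventually_gt_atTop 0] with n hn
            simp only [Function.comp, anisoGauge_anisoScale hn]
            field_simp
          have h4 := h2.trans_eventuallyEq h3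
          exact (Asymptotics.isLittleO_one_iff ℝ).1
            (h4.trans_isBigO (Asymptotics.isBigO_const_const _ one_ne_zero _))
        have hmain : Tendsto (fun n : ℝ => Real.exp (ℓ x + n *
            (Real.log (P (anisoScale b n x)) - ℓ (anisoScale b n x))) *
              g (anisoScale b n x) * w x) atTop (𝓝 (Real.exp (ℓ x) * g 0 * w x)) := by
          have h1 : Tendsto (fun n : ℝ => ℓ x + n *
            (Real.log (P (anisoScale b n x)) - ℓ (anisoScale b n x))) atTop (𝓝 (ℓ x)) := by
            simpa using hrem.const_add (ℓ x)
          exact (((Real.continuous_exp.tendsto _).comp h1).mul (hg.tendsto.comp hsc)).mul_const _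
        refine hmain.congr' ?_
        filter_upwards [hscU, eventually_gt_atTop 0] with n h1 hn
        rw [hφ n hn, Set.indicator_of_mem hx,
          Set.indicator_of_mem (show x ∈ anisoScale b n ⁻¹' U from h1), hPn n hn x hx h1]
      · rw [Set.indicator_of_notMem hx]
        refine tendsto_const_nhds.congr' ?_
        filter_upwards [eventually_gt_atTop 0] with n hn
        rw [hφ n hn, Set.indicator_of_notMem hx]
  have hval : ∫ x, (partialOrthant b).indicator (fun x => Real.exp (ℓ x) * g 0 * w x) x
      = g 0 * laplaceLimit b a ℓ := by
    rw [integral_indicator hOm, laplaceLimit, ← integral_const_mul]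
    congr 1; ext x; rw [hw]; ring
  rw [hval] at hlim
  have hfar := h.tendsto_setIntegral_diff hS hint hUo h0U (laplaceExponent b a)
  have hsum := hlim.add hfar
  rw [add_zero] at hsum
  refine hsum.congr' ?_
  filter_upwards [eventually_gt_atTop 0] with n hn
  have hint' : IntegrableOn (fun x => P x ^ n * (w x * g x)) S := by
    refine Integrable.mono' hint.abs ?_ ?_
    · exact ((h.continuousOn.rpow_const fun _ _ => Or.inr hn.le).aestronglyMeasurable hS).mul
        hint.aestronglyMeasurable
    · filter_upwards [ae_restrict_mem hS] with x hx
      rw [norm_mul, Real.norm_of_nonneg (Real.rpow_nonneg (h.nonneg x hx) n), Real.norm_eq_abs]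
      exact mul_le_of_le_one_left (abs_nonneg _)
        (Real.rpow_le_one (h.nonneg x hx) (h.le_one x hx) hn.le)
  rw [← integral_inter_add_sdiff hUo.measurableSet hint', mul_add, ← integral_indicator hmUS,
    integral_const_mul, integral_const_mul, ← integral_comp_anisoScale (b := b) hn (f n)]

end Laplace

/-! ### Positive definite forms and Gaussian integrals -/

section Gaussian
variable {κ : Type*} [Fintype κ]

open scoped MatrixOrder ComplexOrder Matrix.Norms.L2Operator in
theorem Matrix.PosDef.exists_eq_transpose_mul_self [DecidableEq κ] {M : Matrix κ κ ℝ}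
    (hM : M.PosDef) : ∃ B : Matrix κ κ ℝ, M = B.transpose * B ∧ B.det ≠ 0 := by
  obtain ⟨B, hB⟩ := CStarAlgebra.nonneg_iff_eq_star_mul_self.mp hM.posSemidef.nonneg
  have hB' : M = B.transpose * B := by
    rw [hB, Matrix.star_eq_conjTranspose, Matrix.conjTranspose_eq_transpose_of_trivial]
  refine ⟨B, hB', fun h0 => ?_⟩
  have := hM.det_pos
  rw [hB', Matrix.det_mul, h0, mul_zero] at this
  exact this.ne rfl

theorem dotProduct_transpose_mul_self_mulVec (B : Matrix κ κ ℝ) (v : κ → ℝ) :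
    v ⬝ᵥ (B.transpose * B).mulVec v = B.mulVec v ⬝ᵥ B.mulVec v := by
  rw [← Matrix.mulVec_mulVec, Matrix.dotProduct_mulVec, Matrix.vecMul_transpose]

/-- Write $M=B^\top B$ and $u=Bv$. Cauchy-Schwarz applied to the rows of $v=B^{-1}u$ bounds $|v|^2$
by the squared Frobenius norm `C` of $B^{-1}$ times $|u|^2=v^\top Mv$. Using `C + 1` avoids a
separate case `C = 0`. -/
theorem Matrix.PosDef.exists_sq_le {M : Matrix κ κ ℝ} (hM : M.PosDef) :
    ∃ c > 0, ∀ v : κ → ℝ, c * ∑ j, v j ^ 2 ≤ v ⬝ᵥ M.mulVec v := by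
  classical
  obtain ⟨B, rfl, hB⟩ := hM.exists_eq_transpose_mul_self
  set C : ℝ := ∑ i, ∑ j, B⁻¹ i j ^ 2 with hC
  have hC0 : 0 ≤ C := Finset.sum_nonneg fun i _ => Finset.sum_nonneg fun j _ => sq_nonneg _
  refine ⟨(C + 1)⁻¹, by positivity, fun v => ?_⟩
  rw [dotProduct_transpose_mul_self_mulVec]
  set u := B.mulVec v with hu
  have hv : v = B⁻¹.mulVec u := by
    rw [hu, Matrix.mulVec_mulVec, Matrix.nonsing_inv_mul _ hB.isUnit, Matrix.one_mulVec]
  have h1 : ∑ j, v j ^ 2 ≤ C * (u ⬝ᵥ u) := by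
    rw [hC, Finset.sum_mul]
    refine Finset.sum_le_sum fun i _ => ?_
    have : u ⬝ᵥ u = ∑ j, u j ^ 2 := by simp [dotProduct, sq]
    rw [this]
    nth_rewrite 1 [hv]
    exact Finset.sum_mul_sq_le_sq_mul_sq _ _ _
  have h2 : 0 ≤ u ⬝ᵥ u := by
    simp only [dotProduct]
    exact Finset.sum_nonneg fun j _ => mul_self_nonneg _
  rw [inv_mul_le_iff₀ (by positivity)]
  linarith

/-- The Gaussian integral of a positive definite matrix. -/
theorem integral_exp_neg_half_dotProduct_mulVec [DecidableEq κ] {M : Matrix κ κ ℝ}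
    (hM : M.PosDef) :
    ∫ v : κ → ℝ, Real.exp (-(1 / 2) * (v ⬝ᵥ M.mulVec v)) =
      (Real.sqrt M.det)⁻¹ * Real.sqrt (2 * Real.pi) ^ Fintype.card κ := by
  obtain ⟨B, rfl, hB⟩ := hM.exists_eq_transpose_mul_self
  simp_rw [dotProduct_transpose_mul_self_mulVec]
  rw [integral_comp_mulVec B hB fun v => Real.exp (-(1 / 2) * (v ⬝ᵥ v)), Matrix.det_mul,
    Matrix.det_transpose, Real.sqrt_mul_self_eq_abs]
  congr 1
  have h : ∀ v : κ → ℝ, Real.exp (-(1 / 2) * (v ⬝ᵥ v)) =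
      ∏ j, Real.exp (-(1 / 2) * (v j) ^ 2) := by
    intro v
    rw [← Real.exp_sum, ← Finset.mul_sum]
    simp [dotProduct, sq]
  simp_rw [h]
  rw [integral_fintype_prod_volume_eq_pow (fun t : ℝ => Real.exp (-(1 / 2) * t ^ 2)),
    integral_gaussian]
  congr 2
  ring

end Gaussian

/-! ### The leading phase and its limiting integral -/

section Limit
variable {ι κ : Type*} [Fintype ι] [Fintype κ] {b : ι → Prop} [DecidablePred b]

theorem prod_ite_eq_prod_subtype (f : ι → ℝ) :
    (∏ i, if b i then f i else 1) = ∏ i : {i // b i}, f i := by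
  rw [← Finset.prod_filter, Finset.prod_subtype _ (p := b) (by simp)]

theorem sum_ite_eq_sum_subtype (f : ι → ℝ) :
    (∑ i, if b i then f i else 0) = ∑ i : {i // b i}, f i := by
  rw [← Finset.sum_filter, Finset.sum_subtype _ (p := b) (by simp)]

/-- The phase that is linear in the coordinates selected by `b` and quadratic in the others. -/
noncomputable def boundaryPhase (lam : ι → ℝ) (e : κ ≃ {i // ¬ b i}) (M : Matrix κ κ ℝ)
    (x : ι → ℝ) : ℝ :=
  -(∑ i, if b i then lam i * x i else 0) +
    -(1 / 2) * ((fun j => x (e j)) ⬝ᵥ M.mulVec fun j => x (e j))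

theorem boundaryPhase_add (lam lam' : ι → ℝ) (e : κ ≃ {i // ¬ b i}) (M M' : Matrix κ κ ℝ)
    (x : ι → ℝ) :
    boundaryPhase lam e M x + boundaryPhase lam' e M' x
      = boundaryPhase (lam + lam') e (M + M') x := by
  simp only [boundaryPhase, sum_ite_eq_sum_subtype, Matrix.add_mulVec, dotProduct_add,
    Pi.add_apply, add_mul, Finset.sum_add_distrib]
  ring

theorem isLeadingPhase_boundaryPhase {lam : ι → ℝ} (hlam : ∀ i, b i → 0 < lam i)
    (e : κ ≃ {i // ¬ b i}) {M : Matrix κ κ ℝ} (hM : M.PosDef) :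
    IsLeadingPhase b (boundaryPhase lam e M) where
  continuous := by
    unfold boundaryPhase
    simp only [sum_ite_eq_sum_subtype, dotProduct, Matrix.mulVec]
    fun_prop
  homogeneous n hn x := by
    have h1 : ∀ i : {i // b i}, anisoScale b n x i = n⁻¹ * x i := fun i => by
      simp [anisoScale, anisoFactor, i.2]
    have h2 : (fun j => anisoScale b n x (e j)) = (Real.sqrt n)⁻¹ • fun j => x (e j) := by
      ext j
      simp [anisoScale, anisoFactor, (e j).2]
    unfold boundaryPhase
    rw [h2, sum_ite_eq_sum_subtype, sum_ite_eq_sum_subtype, Matrix.mulVec_smul, dotProduct_smul,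
      smul_dotProduct]
    simp_rw [h1]
    have h3 : (Real.sqrt n)⁻¹ * (Real.sqrt n)⁻¹ = n⁻¹ := by
      rw [← mul_inv, Real.mul_self_sqrt hn.le]
    have h4 : ∑ i : {i // b i}, lam i * (n⁻¹ * x i) = n⁻¹ * ∑ i : {i // b i}, lam i * x i := by
      rw [Finset.mul_sum]; exact Finset.sum_congr rfl fun i _ => by ring
    rw [h4, smul_eq_mul, smul_eq_mul, ← mul_assoc (Real.sqrt n)⁻¹, h3]
    ring
  coercive := by
    obtain ⟨c, hc, hM⟩ := hM.exists_sq_le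
    have hbd : ∃ δ > 0, ∀ i, b i → δ ≤ lam i := by
      rcases isEmpty_or_nonempty {i // b i} with h | h
      · exact ⟨1, one_pos, fun i hi => (h.false ⟨i, hi⟩).elim⟩
      · obtain ⟨i, hi⟩ := Finite.exists_min fun i : {i // b i} => lam i
        exact ⟨lam i, hlam i i.2, fun j hj => hi ⟨j, hj⟩⟩
    obtain ⟨δ, hδ, hbd⟩ := hbd
    -- `c / 2` rather than `c` because the quadratic form enters the phase with the factor $1/2$.
    refine ⟨min δ (c / 2), lt_min hδ (half_pos hc), fun x hx => ?_⟩
    have hgauge : anisoGauge b x = ∑ i : {i // b i}, x i + ∑ j, x (e j) ^ 2 := by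
      unfold anisoGauge
      rw [Finset.sum_ite, Finset.sum_subtype _ (p := b) (by simp),
        Finset.sum_subtype _ (p := fun i => ¬ b i) (by simp), e.sum_comp (fun i => x i ^ 2)]
      congr 1
      exact Finset.sum_congr rfl fun i _ => abs_of_nonneg (hx i i.2)
    have h1 : min δ (c / 2) * ∑ i : {i // b i}, x i ≤ ∑ i : {i // b i}, lam i * x i := by
      rw [Finset.mul_sum]
      exact Finset.sum_le_sum fun i _ =>
        mul_le_mul_of_nonneg_right ((min_le_left _ _).trans (hbd i i.2)) (hx i i.2)
    have h2 : min δ (c / 2) * ∑ j, x (e j) ^ 2 ≤ c / 2 * ∑ j, x (e j) ^ 2 :=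
      mul_le_mul_of_nonneg_right (min_le_right _ _) (Finset.sum_nonneg fun j _ => sq_nonneg _)
    have h3 := hM fun j => x (e j)
    rw [hgauge]
    unfold boundaryPhase
    rw [sum_ite_eq_sum_subtype]
    linarith

/-- The limiting integral is a product of Gamma integrals and a Gaussian integral. -/
theorem laplaceLimit_boundaryPhase [DecidableEq κ] {a lam : ι → ℝ} (ha : ∀ i, b i → 0 < a i)
    (hlam : ∀ i, b i → 0 < lam i) (e : κ ≃ {i // ¬ b i}) {M : Matrix κ κ ℝ} (hM : M.PosDef) :
    laplaceLimit b a (boundaryPhase lam e M) =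
      (∏ i, if b i then (1 / lam i) ^ a i * Real.Gamma (a i) else 1) *
        ((Real.sqrt M.det)⁻¹ * Real.sqrt (2 * Real.pi) ^ Fintype.card κ) := by
  let k : {i // b i} → ℝ → ℝ := fun i =>
    (Set.Ici (0 : ℝ)).indicator fun t => t ^ (a i - 1) * Real.exp (-(lam i * t))
  let G : ({i // ¬ b i} → ℝ) → ℝ := fun y =>
    Real.exp (-(1 / 2) * ((fun j => y (e j)) ⬝ᵥ M.mulVec fun j => y (e j)))
  -- The orthant constrains only the coordinates selected by `b`, one at a time, so its indicator
  -- can be absorbed into the one-dimensional factors and Fubini applies.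
  have hsplit : ∀ x : ι → ℝ, (partialOrthant b).indicator
      (fun x => Real.exp (boundaryPhase lam e M x) * boundaryWeight b a x) x =
      (∏ i, k i ((MeasurableEquiv.piEquivPiSubtypeProd (fun _ : ι => ℝ) b x).1 i)) *
        G (MeasurableEquiv.piEquivPiSubtypeProd (fun _ : ι => ℝ) b x).2 := by
    intro x
    change _ = (∏ i : {i // b i}, k i (x i)) * Real.exp (-(1 / 2) *
      ((fun j => x (e j)) ⬝ᵥ M.mulVec fun j => x (e j)))
    by_cases hx : x ∈ partialOrthant b
    · rw [Set.indicator_of_mem hx, boundaryPhase, boundaryWeight, prod_ite_eq_prod_subtype,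
        sum_ite_eq_sum_subtype, Real.exp_add, ← Finset.sum_neg_distrib, Real.exp_sum,
        mul_right_comm, ← Finset.prod_mul_distrib]
      congr 1
      refine Finset.prod_congr rfl fun i _ => ?_
      simp only [k, Set.indicator_of_mem (Set.mem_Ici.2 (hx i i.2))]
      ring
    · rw [Set.indicator_of_notMem hx]
      simp only [partialOrthant, Set.mem_ofPred_eq, not_forall, not_le] at hx
      obtain ⟨i, hi, hxi⟩ := hx
      rw [Finset.prod_eq_zero (Finset.mem_univ (⟨i, hi⟩ : {i // b i})), zero_mul]
      exact Set.indicator_of_notMem (by simpa using hxi) _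
  have hk : ∀ i, ∫ t, k i t = (1 / lam i) ^ a i * Real.Gamma (a i) := by
    intro i
    rw [integral_indicator measurableSet_Ici, integral_Ici_eq_integral_Ioi,
      Real.integral_rpow_mul_exp_neg_mul_Ioi (ha i i.2) (hlam i i.2)]
  have hG : ∫ y, G y = (Real.sqrt M.det)⁻¹ * Real.sqrt (2 * Real.pi) ^ Fintype.card κ := by
    rw [← integral_exp_neg_half_dotProduct_mulVec hM,
      ← (volume_measurePreserving_piCongrLeft (fun _ => ℝ) e).integral_comp' G]
    refine integral_congr_ae (ae_of_all _ fun v => ?_)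
    have : (fun j => MeasurableEquiv.piCongrLeft (fun _ => ℝ) e v (e j)) = v := by
      ext j
      rw [MeasurableEquiv.coe_piCongrLeft]
      exact Equiv.piCongrLeft_apply_apply (fun _ => ℝ) e v j
    simp only [G, this]
  rw [laplaceLimit, ← integral_indicator measurableSet_partialOrthant]
  simp_rw [hsplit]
  rw [(volume_preserving_piEquivPiSubtypeProd (fun _ : ι => ℝ) b).integral_comp'
    (g := fun p => (∏ i, k i (p.1 i)) * G p.2), Measure.volume_eq_prod,
    integral_prod_mul (fun u : {i // b i} → ℝ => ∏ i, k i (u i)) G, hG,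
    integral_fintype_prod_volume_eq_prod, prod_ite_eq_prod_subtype]
  simp_rw [hk]

end Limit

/-! ### Integrability of the Dirichlet density -/

section Dirichlet

/-- The extension of `t ↦ t ^ (a - 1)` by zero to the negative reals. -/
noncomputable def truncPow (a : ℝ) : ℝ → ℝ := (Set.Ici 0).indicator fun t => t ^ (a - 1)

theorem truncPow_mul {s : ℝ} (hs : 0 < s) (a t : ℝ) :
    truncPow a (s * t) = s ^ (a - 1) * truncPow a t := by
  unfold truncPow
  by_cases ht : 0 ≤ t
  · rw [Set.indicator_of_mem (Set.mem_Ici.2 (mul_nonneg hs.le ht)),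
      Set.indicator_of_mem (Set.mem_Ici.2 ht), Real.mul_rpow hs.le ht]
  · have : ¬ 0 ≤ s * t := by rwa [mul_nonneg_iff_of_pos_left hs]
    rw [Set.indicator_of_notMem (mt Set.mem_Ici.1 this),
      Set.indicator_of_notMem (mt Set.mem_Ici.1 ht), mul_zero]

theorem integrable_truncPow_mul_exp_neg {a : ℝ} (ha : 0 < a) :
    Integrable fun t => truncPow a t * Real.exp (-t) := by
  have : (fun t => truncPow a t * Real.exp (-t)) =
      (Set.Ici (0 : ℝ)).indicator fun t => Real.exp (-t) * t ^ (a - 1) := by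
    ext t
    unfold truncPow
    by_cases ht : t ∈ Set.Ici (0 : ℝ)
    · rw [Set.indicator_of_mem ht, Set.indicator_of_mem ht, mul_comm]
    · rw [Set.indicator_of_notMem ht, Set.indicator_of_notMem ht, zero_mul]
  rw [this, integrable_indicator_iff measurableSet_Ici, integrableOn_Ici_iff_integrableOn_Ioi]
  exact Real.GammaIntegral_convergent ha

/-- The Dirichlet integrand is integrable over some dilated simplex. -/
theorem exists_integrable_prod_truncPow (k : ℕ) (a : Fin k → ℝ) (c : ℝ) (ha : ∀ i, 0 < a i)
    (hc : 0 < c) : ∃ s > 0, Integrable fun y : Fin k → ℝ =>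
      (∏ i, truncPow (a i) (y i)) * truncPow c (s - ∑ i, y i) := by
  let F : (Fin k → ℝ) × ℝ → ℝ := fun p =>
    (∏ i, truncPow (a i) (p.1 i) * Real.exp (-p.1 i)) * (truncPow c p.2 * Real.exp (-p.2))
  have hF : Integrable F (volume.prod volume) :=
    Integrable.mul_prod (f := fun y : Fin k → ℝ => ∏ i, truncPow (a i) (y i) * Real.exp (-y i))
      (Integrable.fintype_prod fun i => integrable_truncPow_mul_exp_neg (ha i))
      (integrable_truncPow_mul_exp_neg hc)
  -- Gamma densities have an integrable product on $\mathbb R^{k+1}$. This shear makes the total `s`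
  -- of all variables the last coordinate. Almost every slice of fixed `s` is then integrable, and
  -- on it the exponentials multiply to the constant $e^{-s}$.
  have hT : MeasurePreserving (fun p : (Fin k → ℝ) × ℝ => (p.1, p.2 - ∑ i, p.1 i))
      (volume.prod volume) (volume.prod volume) := by
    refine MeasurePreserving.skew_product (g := fun (y : Fin k → ℝ) (s : ℝ) => s - ∑ i, y i)
      (MeasurePreserving.id _) (by unfold Function.uncurry; fun_prop) (ae_of_all _ fun y => ?_)
    exact (measurePreserving_sub_right volume (∑ i, y i)).map_eq
  have hFT := (hT.integrable_comp hF.aestronglyMeasurable).2 hF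
  have hae := hFT.prod_left_ae
  have : ∃ᵐ s : ℝ, 0 < s := by
    intro h
    have h0 : volume (Set.Ioi (0 : ℝ)) = 0 := by
      rw [ae_iff] at h
      simpa [Set.Ioi] using h
    simp at h0
  obtain ⟨s, hs, hint⟩ := (this.and_eventually hae).exists
  refine ⟨s, hs, ?_⟩
  refine (hint.const_mul (Real.exp s)).congr (ae_of_all _ fun y => ?_)
  simp only [Function.comp, F, Finset.prod_mul_distrib, ← Real.exp_sum]
  have : Real.exp s * (Real.exp (∑ i, -y i) * Real.exp (-(s - ∑ i, y i))) = 1 := by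
    rw [← Real.exp_add, ← Real.exp_add, Finset.sum_neg_distrib, Real.exp_eq_one_iff]
    ring
  linear_combination (∏ i, truncPow (a i) (y i)) * truncPow c (s - ∑ i, y i) * this

/-- Truncated powers are homogeneous, so dilation by `s` carries the simplex of size `s`, where
integrability is known, to the standard one. -/
theorem integrable_prod_truncPow (k : ℕ) (a : Fin k → ℝ) (c : ℝ) (ha : ∀ i, 0 < a i)
    (hc : 0 < c) : Integrable fun y : Fin k → ℝ =>
      (∏ i, truncPow (a i) (y i)) * truncPow c (1 - ∑ i, y i) := by
  obtain ⟨s, hs, h⟩ := exists_integrable_prod_truncPow k a c ha hc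
  rw [← integrable_comp_smul_iff volume _ hs.ne'] at h
  have hC : (∏ i, s ^ (a i - 1)) * s ^ (c - 1) ≠ 0 :=
    mul_ne_zero (Finset.prod_ne_zero_iff.2 fun i _ => (Real.rpow_pos_of_pos hs _).ne')
      (Real.rpow_pos_of_pos hs _).ne'
  refine (h.const_mul ((∏ i, s ^ (a i - 1)) * s ^ (c - 1))⁻¹).congr (ae_of_all _ fun y => ?_)
  have h1 : s - ∑ i, s * y i = s * (1 - ∑ i, y i) := by
    rw [← Finset.mul_sum]; ring
  simp only [Pi.smul_apply, smul_eq_mul, h1, truncPow_mul hs, Finset.prod_mul_distrib]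
  field_simp

theorem measurableSet_projSimplex (K : ℕ) : MeasurableSet (projSimplex K) := by
  have : projSimplex K = (⋂ i, {y | 0 ≤ y i}) ∩ {y | ∑ i, y i ≤ 1} := by
    ext y; simp [projSimplex]
  rw [this]
  refine (MeasurableSet.iInter fun i => measurableSet_le measurable_const
    (measurable_pi_apply i)).inter (measurableSet_le (by fun_prop) measurable_const)

theorem prod_liftSimplex_succ (k : ℕ) (f : Fin (k + 1) → ℝ → ℝ) (y : Fin k → ℝ) :
    ∏ i, f i (liftSimplex (k + 1) y i) =
      (∏ i : Fin k, f i.castSucc (y i)) * f (Fin.last k) (1 - ∑ i, y i) := by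
  rw [Fin.prod_univ_castSucc]
  congr 1
  · refine Finset.prod_congr rfl fun i _ => ?_
    simp [liftSimplex]
  · simp [liftSimplex]

theorem integrableOn_prod_liftSimplex {K : ℕ} (hK : 1 ≤ K) {α : Fin K → ℝ} (hα : ∀ i, 0 < α i) :
    IntegrableOn (fun y => ∏ i, liftSimplex K y i ^ (α i - 1)) (projSimplex K) := by
  obtain ⟨k, rfl⟩ : ∃ k, K = k + 1 := ⟨K - 1, by omega⟩
  rw [← integrable_indicator_iff (measurableSet_projSimplex _)]
  refine (integrable_prod_truncPow k (fun i => α i.castSucc) (α (Fin.last k)) (fun i => hα _)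
    (hα _)).congr (ae_of_all _ fun y => ?_)
  have h := prod_liftSimplex_succ k (fun i t => t ^ (α i - 1)) y
  by_cases hy : y ∈ projSimplex (k + 1)
  · rw [Set.indicator_of_mem hy, h]
    have h1 : 0 ≤ 1 - ∑ i, y i := sub_nonneg.2 hy.2
    have h2 : ∀ i, truncPow (α (Fin.castSucc i)) (y i) = y i ^ (α (Fin.castSucc i) - 1) :=
      fun i => Set.indicator_of_mem (Set.mem_Ici.2 (hy.1 i)) _
    have h3 : truncPow (α (Fin.last k)) (1 - ∑ i, y i) = (1 - ∑ i, y i) ^ (α (Fin.last k) - 1) :=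
      Set.indicator_of_mem (Set.mem_Ici.2 h1) _
    simp only [h2]
    exact congrArg _ h3
  · rw [Set.indicator_of_notMem hy]
    by_cases h2 : ∀ i, 0 ≤ y i
    · have h1 : ¬ 0 ≤ 1 - ∑ i, y i := fun h3 => hy ⟨h2, sub_nonneg.1 h3⟩
      refine mul_eq_zero_of_right _ (Set.indicator_of_notMem (by simpa using h1) _)
    · push Not at h2
      obtain ⟨i, hi⟩ := h2
      refine mul_eq_zero_of_left (Finset.prod_eq_zero (Finset.mem_univ i) ?_) _
      exact Set.indicator_of_notMem (by simpa using hi) _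

end Dirichlet

/-! ### Second-order expansion measured by the anisotropic gauge -/

section Taylor

/-- Second-order Taylor expansion with little-o remainder. -/
theorem ContDiffAt.taylor_two_isLittleO {E : Type*} [NormedAddCommGroup E] [NormedSpace ℝ E]
    {F : E → ℝ} {x₀ : E} (hF : ContDiffAt ℝ 2 F x₀) :
    (fun z => F (x₀ + z) - F x₀ - fderiv ℝ F x₀ z - 1 / 2 * fderiv ℝ (fderiv ℝ F) x₀ z z)
      =o[𝓝 0] fun z => ‖z‖ ^ 2 := by
  set B := fderiv ℝ (fderiv ℝ F) x₀ with hB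
  have hsymm : IsSymmSndFDerivAt ℝ F x₀ := hF.isSymmSndFDerivAt (by simp)
  have hd1 : ∀ᶠ x in 𝓝 x₀, DifferentiableAt ℝ F x :=
    (hF.eventually (by simp)).mono fun x hx => hx.differentiableAt (by simp)
  have hd2 : HasFDerivAt (fderiv ℝ F) B x₀ :=
    ((hF.fderiv_right (m := 1) (by norm_num)).differentiableAt (by simp)).hasFDerivAt
  rw [Asymptotics.isLittleO_iff]
  intro ε hε
  have hlo := hasFDerivAt_iff_isLittleO_nhds_zero.1 hd2
  have htr : Tendsto (fun z => x₀ + z) (𝓝 (0 : E)) (𝓝 x₀) := by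
    simpa using (continuous_const_add x₀).tendsto 0
  have hev := (hlo.bound hε).and (htr.eventually hd1)
  obtain ⟨δ, hδ, hball⟩ := Metric.eventually_nhds_iff_ball.1 hev
  refine Metric.eventually_nhds_iff_ball.2 ⟨δ, hδ, fun z hz => ?_⟩
  -- The derivative of the remainder at `w` is the first-order remainder of `fderiv ℝ F`, hence at
  -- most $\varepsilon\|w\|$ near zero; the mean value inequality on the ball of radius $\|z\|$
  -- gives $\varepsilon\|z\|^2$. Symmetry of the second derivative identifies the derivative of
  -- $B(z,z)/2$.
  let r : E → ℝ := fun z => F (x₀ + z) - F x₀ - fderiv ℝ F x₀ z - 1 / 2 * B z z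
  have hr : ∀ w ∈ Metric.closedBall (0 : E) ‖z‖,
      HasFDerivWithinAt r (fderiv ℝ F (x₀ + w) - fderiv ℝ F x₀ - B w)
        (Metric.closedBall 0 ‖z‖) w := by
    intro w hw
    have hwδ : w ∈ Metric.ball (0 : E) δ := by
      rw [mem_ball_zero_iff] at hz ⊢
      exact (mem_closedBall_zero_iff.1 hw).trans_lt hz
    have h1 : HasFDerivAt (fun z => F (x₀ + z)) (fderiv ℝ F (x₀ + w)) w := by
      have := (hball w hwδ).2.hasFDerivAt
      exact (hasFDerivAt_comp_add_left x₀).2 this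
    have h2 : HasFDerivAt (fun z => B z z) ((B w).comp (ContinuousLinearMap.id ℝ E) + B.flip w) w :=
      B.hasFDerivAt.clm_apply (hasFDerivAt_id w)
    have h3 := ((h1.sub_const (F x₀)).sub (fderiv ℝ F x₀).hasFDerivAt).sub (h2.const_mul (1 / 2))
    refine HasFDerivAt.hasFDerivWithinAt ?_
    refine h3.congr_fderiv ?_
    ext v
    have hs : B v w = B w v := hsymm.eq v w
    simp [hs]
    ring
  have hbound := (convex_closedBall (0 : E) ‖z‖).norm_image_sub_le_of_norm_hasFDerivWithin_le
    (C := ε * ‖z‖) hr (fun w hw => ?_) (Metric.mem_closedBall_self (norm_nonneg z))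
    (mem_closedBall_zero_iff.2 le_rfl : z ∈ _)
  · have hr0 : r 0 = 0 := by simp [r]
    rw [hr0, sub_zero, sub_zero] at hbound
    calc _ = ‖r z‖ := rfl
      _ ≤ ε * ‖z‖ * ‖z‖ := hbound
      _ = ε * ‖‖z‖ ^ 2‖ := by rw [Real.norm_of_nonneg (sq_nonneg _)]; ring
  · have hwz := mem_closedBall_zero_iff.1 hw
    have hwδ : w ∈ Metric.ball (0 : E) δ := by
      rw [mem_ball_zero_iff] at hz ⊢
      exact hwz.trans_lt hz
    exact (hball w hwδ).1.trans (mul_le_mul_of_nonneg_left hwz hε.le)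

variable {ι : Type*} [Fintype ι] {b : ι → Prop} [DecidablePred b]

/-- In the unit ball $x_i^2\le|x_i|$, so the gauge dominates each squared coordinate. Taylor
remainders are thereby negligible relative to the gauge. -/
theorem norm_sq_isBigO_anisoGauge : (fun x : ι → ℝ => ‖x‖ ^ 2) =O[𝓝 0] anisoGauge b := by
  refine Asymptotics.IsBigO.of_bound 1 ?_
  filter_upwards [Metric.ball_mem_nhds (0 : ι → ℝ) one_pos] with x hx
  rw [mem_ball_zero_iff] at hx
  rw [one_mul, Real.norm_of_nonneg (sq_nonneg _), Real.norm_of_nonneg (anisoGauge_nonneg x)]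
  have h1 : ∀ i, x i ^ 2 ≤ anisoGauge b x := by
    intro i
    have hi : |x i| ≤ 1 := (norm_le_pi_norm x i).trans hx.le
    have : x i ^ 2 ≤ if b i then |x i| else x i ^ 2 := by
      split_ifs
      · rw [← sq_abs]; nlinarith [abs_nonneg (x i)]
      · exact le_rfl
    refine this.trans ?_
    exact Finset.single_le_sum (f := fun i => if b i then |x i| else x i ^ 2)
      (fun j _ => by split_ifs <;> positivity) (Finset.mem_univ i)
  have h2 : ‖x‖ ≤ Real.sqrt (anisoGauge b x) := by
    refine (pi_norm_le_iff_of_nonneg (Real.sqrt_nonneg _)).2 fun i => ?_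
    exact Real.abs_le_sqrt (h1 i)
  calc ‖x‖ ^ 2 ≤ Real.sqrt (anisoGauge b x) ^ 2 := by gcongr
    _ = anisoGauge b x := Real.sq_sqrt (anisoGauge_nonneg x)

/-- Setting the coordinates selected by `b` to zero. -/
def interiorPart (b : ι → Prop) [DecidablePred b] (x : ι → ℝ) : ι → ℝ :=
  fun i => if b i then 0 else x i

theorem norm_sub_interiorPart_le (x : ι → ℝ) : ‖x - interiorPart b x‖ ≤ anisoGauge b x := by
  refine (pi_norm_le_iff_of_nonneg (anisoGauge_nonneg x)).2 fun i => ?_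
  have : ‖(x - interiorPart b x) i‖ ≤ if b i then |x i| else x i ^ 2 := by
    simp only [Pi.sub_apply, interiorPart]
    split_ifs
    · simp
    · simpa using sq_nonneg (x i)
  refine this.trans ?_
  exact Finset.single_le_sum (f := fun i => if b i then |x i| else x i ^ 2)
    (fun j _ => by split_ifs <;> positivity) (Finset.mem_univ i)

theorem norm_interiorPart_le (x : ι → ℝ) : ‖interiorPart b x‖ ≤ ‖x‖ := by
  refine (pi_norm_le_iff_of_nonneg (norm_nonneg x)).2 fun i => ?_
  unfold interiorPart
  split_ifs
  · simp
  · exact norm_le_pi_norm x i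

/-- In a quadratic form the coordinates selected by `b` contribute only to higher order. -/
theorem bilinear_sub_interiorPart_isLittleO (B : (ι → ℝ) →L[ℝ] (ι → ℝ) →L[ℝ] ℝ) :
    (fun x => B x x - B (interiorPart b x) (interiorPart b x)) =o[𝓝 0] anisoGauge b := by
  have h1 : (fun x => B x x - B (interiorPart b x) (interiorPart b x)) =O[𝓝 0]
      fun x => ‖x‖ * anisoGauge b x := by
    refine Asymptotics.IsBigO.of_bound (2 * ‖B‖) (Eventually.of_forall fun x => ?_)
    have hdec : B x x - B (interiorPart b x) (interiorPart b x) =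
        B (x - interiorPart b x) x + B (interiorPart b x) (x - interiorPart b x) := by
      simp
    have e1 := B.le_opNorm₂ (x - interiorPart b x) x
    have e2 := B.le_opNorm₂ (interiorPart b x) (x - interiorPart b x)
    have e3 : ‖B‖ * ‖x - interiorPart b x‖ * ‖x‖ ≤ ‖B‖ * anisoGauge b x * ‖x‖ := by
      gcongr; exact norm_sub_interiorPart_le x
    have e4 : ‖B‖ * ‖interiorPart b x‖ * ‖x - interiorPart b x‖ ≤
        ‖B‖ * ‖x‖ * anisoGauge b x := by
      gcongr
      · exact norm_interiorPart_le x
      · exact norm_sub_interiorPart_le x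
    rw [hdec, norm_mul, norm_norm, Real.norm_of_nonneg (anisoGauge_nonneg x)]
    refine (norm_add_le _ _).trans ?_
    linarith
  have h2 : (fun x : ι → ℝ => ‖x‖ * anisoGauge b x) =o[𝓝 0] fun x => 1 * anisoGauge b x := by
    refine Asymptotics.IsLittleO.mul_isBigO ?_ (Asymptotics.isBigO_refl _ _)
    rw [Asymptotics.isLittleO_one_iff]
    simpa using (continuous_norm (E := ι → ℝ)).tendsto 0
  simpa using h1.trans_isLittleO h2

end Taylor

/-! ### Coordinates on the simplex and the reduced Hessian -/

section Coordinates

/-- The linear part of `liftSimplex`. -/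
def liftDir (K : ℕ) : (Fin (K - 1) → ℝ) →ₗ[ℝ] (Fin K → ℝ) where
  toFun x := fun i => if h : i.val < K - 1 then x ⟨i.val, h⟩ else - ∑ j, x j
  map_add' x y := by
    ext i
    by_cases h : i.val < K - 1
    · simp [h]
    · simp [h, Finset.sum_add_distrib]; ring
  map_smul' c x := by
    ext i
    by_cases h : i.val < K - 1
    · simp [h]
    · simp [h, Finset.mul_sum]

theorem liftDir_apply (K : ℕ) (x : Fin (K - 1) → ℝ) (i : Fin K) :
    liftDir K x i = if h : i.val < K - 1 then x ⟨i.val, h⟩ else - ∑ j, x j := rfl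

/-- The first `K - 1` coordinates. -/
def dropLast (K : ℕ) (θ : Fin K → ℝ) : Fin (K - 1) → ℝ :=
  fun i => θ ⟨i.val, i.isLt.trans_le (Nat.sub_le K 1)⟩

theorem liftSimplex_add (K : ℕ) (y x : Fin (K - 1) → ℝ) :
    liftSimplex K (y + x) = liftSimplex K y + liftDir K x := by
  ext i
  by_cases h : i.val < K - 1
  · simp [liftSimplex, liftDir_apply, h]
  · simp [liftSimplex, liftDir_apply, h, Finset.sum_add_distrib]; ring

theorem sum_eq_sum_dropLast_add {K : ℕ} (hK : 1 ≤ K) (θ : Fin K → ℝ) :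
    ∑ i, θ i = ∑ j, dropLast K θ j + θ ⟨K - 1, by omega⟩ := by
  obtain ⟨k, rfl⟩ : ∃ k, K = k + 1 := ⟨K - 1, by omega⟩
  exact Fin.sum_univ_castSucc θ

theorem liftSimplex_dropLast {K : ℕ} (hK : 1 ≤ K) {θ : Fin K → ℝ} (hθ : ∑ i, θ i = 1) :
    liftSimplex K (dropLast K θ) = θ := by
  ext i
  by_cases h : i.val < K - 1
  · simp [liftSimplex, dropLast, h]
  · have hi : i = ⟨K - 1, by omega⟩ := by ext; simp; omega
    have := sum_eq_sum_dropLast_add hK θ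
    simp only [liftSimplex, h, dif_neg, not_false_eq_true]
    rw [hi]; linarith

theorem sum_liftSimplex {K : ℕ} (hK : 1 ≤ K) (y : Fin (K - 1) → ℝ) :
    ∑ i, liftSimplex K y i = 1 := by
  rw [sum_eq_sum_dropLast_add hK]
  have : dropLast K (liftSimplex K y) = y := by
    ext j; simp [dropLast, liftSimplex]
  rw [this]
  simp [liftSimplex]

theorem sum_liftDir {K : ℕ} (hK : 1 ≤ K) (x : Fin (K - 1) → ℝ) : ∑ i, liftDir K x i = 0 := by
  rw [sum_eq_sum_dropLast_add hK]
  have : dropLast K (liftDir K x) = x := by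
    ext j; simp [dropLast, liftDir_apply]
  rw [this]
  simp [liftDir_apply]

theorem liftSimplex_mem_stdSimplex_iff {K : ℕ} (hK : 1 ≤ K) {y : Fin (K - 1) → ℝ} :
    liftSimplex K y ∈ stdSimplex ℝ (Fin K) ↔ y ∈ projSimplex K := by
  constructor
  · rintro ⟨h0, -⟩
    refine ⟨fun i => ?_, ?_⟩
    · simpa [liftSimplex] using h0 ⟨i.val, by omega⟩
    · simpa [liftSimplex] using h0 ⟨K - 1, by omega⟩
  · rintro ⟨h0, h1⟩
    refine ⟨fun i => ?_, sum_liftSimplex hK y⟩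
    unfold liftSimplex
    split_ifs with h
    · exact h0 _
    · exact sub_nonneg.2 h1

theorem continuous_liftSimplex (K : ℕ) : Continuous (liftSimplex K) := by
  refine continuous_pi fun i => ?_
  unfold liftSimplex
  split_ifs <;> fun_prop

theorem liftSimplex_injective (K : ℕ) : Function.Injective (liftSimplex K) := by
  intro x y h
  ext j
  have := congrFun h ⟨j.val, by omega⟩
  simpa [liftSimplex] using this

theorem measurableEmbedding_liftSimplex (K : ℕ) : MeasurableEmbedding (liftSimplex K) :=
  (continuous_liftSimplex K).measurableEmbedding (liftSimplex_injective K)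

theorem isCompact_projSimplex {K : ℕ} (hK : 1 ≤ K) : IsCompact (projSimplex K) := by
  have h : projSimplex K = dropLast K '' stdSimplex ℝ (Fin K) := by
    ext y
    constructor
    · intro hy
      refine ⟨liftSimplex K y, (liftSimplex_mem_stdSimplex_iff hK).2 hy, ?_⟩
      ext j; simp [dropLast, liftSimplex]
    · rintro ⟨θ, hθ, rfl⟩
      rw [← liftSimplex_mem_stdSimplex_iff hK, liftSimplex_dropLast hK hθ.2]
      exact hθ
  rw [h]
  exact (isCompact_stdSimplex ℝ (Fin K)).image
    (continuous_pi fun i => continuous_apply _)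

/-- The free coordinates that are interior, when the first `m` coordinates are on the boundary. -/
def interiorEquiv (K m : ℕ) : Fin (K - 1 - m) ≃ {i : Fin (K - 1) // ¬ i.val < m} where
  toFun j := ⟨⟨m + j.val, by omega⟩, by simp⟩
  invFun i := ⟨i.1.val - m, by have := i.2; omega⟩
  left_inv j := by ext; simp
  right_inv i := by have := i.2; ext; simp; omega

/-- This identifies the matrix `U` of the statement with the tangent map of the simplex chart
restricted to interior coordinates, so that reduced Hessians appear in the Taylor expansion. -/
theorem basisU_mulVec {K m : ℕ} (hm : m + 1 ≤ K) (x : Fin (K - 1) → ℝ) :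
    (basisU K m).mulVec (fun j => x (interiorEquiv K m j)) =
      liftDir K (interiorPart (fun i : Fin (K - 1) => i.val < m) x) := by
  ext i
  rw [liftDir_apply]
  simp only [Matrix.mulVec, dotProduct, basisU, Matrix.of_apply]
  by_cases h : i.val < K - 1
  · rw [dif_pos h]
    have h' : i.val ≠ K - 1 := h.ne
    simp only [h', if_false, ite_mul, one_mul, zero_mul, interiorPart]
    split_ifs with hb
    · refine Finset.sum_eq_zero fun j _ => ?_
      rw [if_neg (by omega)]
    · rw [Finset.sum_eq_single ((interiorEquiv K m).symm ⟨⟨i.val, h⟩, hb⟩)]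
      · rw [if_pos, Equiv.apply_symm_apply]
        simp only [interiorEquiv, Equiv.coe_fn_symm_mk]
        omega
      · intro j _ hj
        rw [if_neg]
        intro hij
        apply hj
        rw [Equiv.eq_symm_apply]
        ext
        simp [interiorEquiv, hij]
      · simp
  · rw [dif_neg h]
    have h' : i.val = K - 1 := by omega
    have h2 : ∀ j : Fin (K - 1 - m), ¬ (K - 1 = m + j.val) := fun j => by omega
    simp only [h', h2, if_false, if_true, neg_one_mul, Finset.sum_neg_distrib]
    congr 1
    have : ∀ i, interiorPart (fun i : Fin (K - 1) => i.val < m) x i =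
        if ¬ i.val < m then x i else 0 := by
      intro i; unfold interiorPart; split_ifs <;> rfl
    simp_rw [this]
    rw [sum_ite_eq_sum_subtype (b := fun i : Fin (K - 1) => ¬ i.val < m)]
    exact (interiorEquiv K m).sum_comp fun i => x i

theorem fderiv_eq_sum_gradVec {K : ℕ} (F : (Fin K → ℝ) → ℝ) (θ z : Fin K → ℝ) :
    fderiv ℝ F θ z = ∑ i, gradVec F θ i * z i := by
  conv_lhs => rw [pi_eq_sum_univ' z]
  simp [gradVec, map_sum, mul_comm]

theorem fderiv_fderiv_eq_hessMat {K : ℕ} (F : (Fin K → ℝ) → ℝ) (θ z w : Fin K → ℝ) :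
    fderiv ℝ (fderiv ℝ F) θ z w = z ⬝ᵥ (hessMat F θ).mulVec w := by
  have hlin : ∀ (L : (Fin K → ℝ) →L[ℝ] ℝ) (u : Fin K → ℝ), L u = ∑ i, u i * L (Pi.single i 1) := by
    intro L u
    conv_lhs => rw [pi_eq_sum_univ' u]
    simp [map_sum]
  set D := fderiv ℝ (fderiv ℝ F) θ with hD
  have h1 : D z w = D.flip w z := rfl
  rw [h1, hlin, dotProduct]
  refine Finset.sum_congr rfl fun i _ => ?_
  rw [ContinuousLinearMap.flip_apply, hlin (D (Pi.single i 1)) w, Matrix.mulVec, dotProduct]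
  congr 1
  exact Finset.sum_congr rfl fun j _ => mul_comm _ _

theorem dotProduct_reducedQ_mulVec {K m : ℕ} (F : (Fin K → ℝ) → ℝ) (θ : Fin K → ℝ)
    (v : Fin (K - 1 - m) → ℝ) : v ⬝ᵥ (reducedQ m F θ).mulVec v =
      (basisU K m).mulVec v ⬝ᵥ (hessMat F θ).mulVec ((basisU K m).mulVec v) := by
  rw [reducedQ, ← Matrix.mulVec_mulVec, ← Matrix.mulVec_mulVec, Matrix.dotProduct_mulVec,
    Matrix.vecMul_transpose]

theorem isSymm_hessMat {K : ℕ} {F : (Fin K → ℝ) → ℝ} {θ : Fin K → ℝ}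
    (hF : ContDiffAt ℝ 2 F θ) : (hessMat F θ).IsSymm := by
  have hsymm : IsSymmSndFDerivAt ℝ F θ := hF.isSymmSndFDerivAt (by simp)
  ext i j
  exact hsymm.eq _ _

/-- `U` is injective with values in the critical cone, where the Hessian is negative definite by
assumption. -/
theorem posDef_neg_reducedQ {K m : ℕ} (hm : m + 1 ≤ K) {F : (Fin K → ℝ) → ℝ} {θ : Fin K → ℝ}
    (hF : ContDiffAt ℝ 2 F θ) (hzero : ∀ i : Fin K, θ i = 0 ↔ i.val < m)
    (hneg : IsNegDefOnCriticalCone F θ) : (-reducedQ m F θ).PosDef := by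
  refine Matrix.PosDef.of_dotProduct_mulVec_pos ?_ fun v hv => ?_
  · rw [Matrix.isHermitian_iff_isSymm]
    refine Matrix.IsSymm.neg ?_
    unfold reducedQ Matrix.IsSymm
    rw [Matrix.transpose_mul, Matrix.transpose_mul, Matrix.transpose_transpose,
      isSymm_hessMat hF, Matrix.mul_assoc]
  · obtain ⟨x, hx⟩ : ∃ x : Fin (K - 1) → ℝ, v = fun j => x (interiorEquiv K m j) :=
      ⟨fun i => if h : ¬ i.val < m then v ((interiorEquiv K m).symm ⟨i, h⟩) else 0, by
        ext j
        have := (interiorEquiv K m j).2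
        simp only [this, not_false_eq_true, dif_pos, Subtype.coe_eta, Equiv.symm_apply_apply]⟩
    have hUv := basisU_mulVec hm x
    rw [← hx] at hUv
    have h := hneg ((basisU K m).mulVec v) ?_ ?_
    · rw [star_trivial, Matrix.neg_mulVec, dotProduct_neg, dotProduct_reducedQ_mulVec]
      linarith
    · rw [hUv]
      refine ⟨sum_liftDir (by omega) _, fun i hi => ?_⟩
      have hi' := (hzero i).1 hi
      rw [liftDir_apply, dif_pos (by omega)]
      simp [interiorPart, hi']
    · intro h0
      apply hv
      ext j
      rw [hUv] at h0
      have h1 := congrFun h0 ⟨(interiorEquiv K m j).1.val, by omega⟩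
      rw [liftDir_apply, dif_pos (by simp)] at h1
      have := (interiorEquiv K m j).2
      simp only [interiorPart, this, if_false] at h1
      rw [hx]
      exact h1

/-- The leading behaviour of a function near a nondegenerate KKT point of the simplex. -/
theorem expansion_liftSimplex {K m : ℕ} (hm : m + 1 ≤ K) {F : (Fin K → ℝ) → ℝ} {θ lam : Fin K → ℝ}
    (hF : ContDiffAt ℝ 2 F θ) (hθ : ∑ i, θ i = 1) (hlam : ∀ i : Fin K, ¬ i.val < m → lam i = 0)
    {μ : ℝ} (hgrad : ∀ i, gradVec F θ i = -lam i + μ) :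
    (fun x => F (liftSimplex K (dropLast K θ + x)) - F θ -
      boundaryPhase (b := fun i : Fin (K - 1) => i.val < m) (dropLast K lam) (interiorEquiv K m)
        (-reducedQ m F θ) x) =o[𝓝 0] anisoGauge fun i : Fin (K - 1) => i.val < m := by
  let A : (Fin (K - 1) → ℝ) →L[ℝ] (Fin K → ℝ) := (liftDir K).toContinuousLinearMap
  have hA : ∀ x, A x = liftDir K x := fun x => rfl
  have h1 := hF.taylor_two_isLittleO.comp_tendsto
    (show Tendsto A (𝓝 0) (𝓝 0) by simpa using A.continuous.tendsto 0)
  have h2 : ((fun z : Fin K → ℝ => ‖z‖ ^ 2) ∘ A) =O[𝓝 0]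
      anisoGauge fun i : Fin (K - 1) => i.val < m := by
    refine Asymptotics.IsBigO.trans ?_ norm_sq_isBigO_anisoGauge
    exact (A.isBigO_id (𝓝 0)).norm_left.norm_right.pow 2
  let B : (Fin (K - 1) → ℝ) →L[ℝ] (Fin (K - 1) → ℝ) →L[ℝ] ℝ :=
    (fderiv ℝ (fderiv ℝ F) θ).bilinearComp A A
  have h3 := bilinear_sub_interiorPart_isLittleO (b := fun i : Fin (K - 1) => i.val < m) B
  refine ((h1.trans_isBigO h2).add (h3.const_mul_left (1 / 2))).congr_left fun x => ?_
  -- The constant `μ` disappears because tangent directions have zero sum. The dependent last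
  -- coordinate contributes nothing because it is inactive and its multiplier is zero.
  have e1 : fderiv ℝ F θ (A x) =
      -∑ i : Fin (K - 1), if i.val < m then dropLast K lam i * x i else 0 := by
    rw [fderiv_eq_sum_gradVec]
    simp_rw [hgrad, add_mul, Finset.sum_add_distrib, ← Finset.mul_sum]
    rw [hA, sum_liftDir (by omega), mul_zero, add_zero]
    simp_rw [neg_mul, Finset.sum_neg_distrib]
    congr 1
    rw [sum_eq_sum_dropLast_add (by omega) fun i => lam i * liftDir K x i,
      hlam _ (show ¬ (⟨K - 1, by omega⟩ : Fin K).val < m by simp; omega), zero_mul, add_zero]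
    refine Finset.sum_congr rfl fun i _ => ?_
    split_ifs with h
    · simp [dropLast, liftDir_apply]
    · exact mul_eq_zero_of_left (hlam ⟨i.val, by omega⟩ h) _
  have e2 : B (interiorPart (fun i : Fin (K - 1) => i.val < m) x)
      (interiorPart (fun i : Fin (K - 1) => i.val < m) x) =
      (fun j => x (interiorEquiv K m j)) ⬝ᵥ
        (reducedQ m F θ).mulVec fun j => x (interiorEquiv K m j) := by
    rw [dotProduct_reducedQ_mulVec, basisU_mulVec hm, ← fderiv_fderiv_eq_hessMat]
    rfl
  have e3 : B x x = fderiv ℝ (fderiv ℝ F) θ (A x) (A x) := rfl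
  simp only [Function.comp, boundaryPhase, e2, e3, hA, liftSimplex_add,
    liftSimplex_dropLast (show 1 ≤ K by omega) hθ, Matrix.neg_mulVec, dotProduct_neg]
  rw [← hA, e1]
  ring

end Coordinates

/-! ### From constrained maxima on the simplex to Laplace phases -/

section Phases

/-- The projected simplex, translated so that `θ` becomes the origin. -/
def shiftedSimplex (K : ℕ) (θ : Fin K → ℝ) : Set (Fin (K - 1) → ℝ) :=
  {x | dropLast K θ + x ∈ projSimplex K}

theorem isCompact_shiftedSimplex {K : ℕ} (hK : 1 ≤ K) (θ : Fin K → ℝ) :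
    IsCompact (shiftedSimplex K θ) :=
  (Homeomorph.addLeft (dropLast K θ)).isCompact_preimage.2 (isCompact_projSimplex hK)

theorem shiftedSimplex_subset {K m : ℕ} {θ : Fin K → ℝ} (hzero : ∀ i : Fin K, θ i = 0 ↔ i.val < m) :
    shiftedSimplex K θ ⊆ partialOrthant fun i : Fin (K - 1) => i.val < m := by
  intro x hx i hi
  have h1 := hx.1 i
  have h2 : dropLast K θ i = 0 := (hzero _).2 hi
  simpa [h2] using h1

/-- Only the constraints of the first `m` coordinates are active at `θ`. The others, including the
one on the sum, which expresses positivity of the last coordinate, are strict and persist nearby. -/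
theorem shiftedSimplex_eventually {K m : ℕ} (hm : m + 1 ≤ K) {θ : Fin K → ℝ}
    (hθ : θ ∈ stdSimplex ℝ (Fin K)) (hzero : ∀ i : Fin K, θ i = 0 ↔ i.val < m) :
    ∀ᶠ x in 𝓝[partialOrthant fun i : Fin (K - 1) => i.val < m] 0, x ∈ shiftedSimplex K θ := by
  have hpos : ∀ i : Fin K, ¬ i.val < m → 0 < θ i := fun i hi =>
    lt_of_le_of_ne (hθ.1 i) fun h => hi ((hzero i).1 h.symm)
  have h1 : ∀ᶠ x in 𝓝 (0 : Fin (K - 1) → ℝ), ∀ i : Fin (K - 1), ¬ i.val < m →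
      0 < (dropLast K θ + x) i := by
    rw [eventually_all]
    intro i
    by_cases hi : i.val < m
    · exact Eventually.of_forall fun x h => (h hi).elim
    · have hc : ContinuousAt (fun x : Fin (K - 1) → ℝ => (dropLast K θ + x) i) 0 :=
        Continuous.continuousAt (by simp only [Pi.add_apply]; fun_prop)
      have h0 : 0 < (fun x : Fin (K - 1) → ℝ => (dropLast K θ + x) i) 0 := by
        simpa [dropLast] using hpos ⟨i.val, by omega⟩ hi
      exact (hc.eventually (lt_mem_nhds h0)).mono fun x hx _ => hx
  have h2 : ∀ᶠ x in 𝓝 (0 : Fin (K - 1) → ℝ), ∑ i, (dropLast K θ + x) i < 1 := by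
    have hc : ContinuousAt (fun x : Fin (K - 1) → ℝ => ∑ i, (dropLast K θ + x) i) 0 :=
      Continuous.continuousAt (by simp only [Pi.add_apply]; fun_prop)
    have h0 : (fun x : Fin (K - 1) → ℝ => ∑ i, (dropLast K θ + x) i) 0 < 1 := by
      have hs := sum_eq_sum_dropLast_add (show 1 ≤ K by omega) θ
      rw [hθ.2] at hs
      have := hpos ⟨K - 1, by omega⟩ (by simp; omega)
      simp only [add_zero]
      linarith
    exact hc.eventually (gt_mem_nhds h0)
  rw [eventually_nhdsWithin_iff]
  filter_upwards [h1, h2] with x hx1 hx2 hx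
  refine ⟨fun i => ?_, hx2.le⟩
  by_cases hi : i.val < m
  · have : dropLast K θ i = 0 := (hzero _).2 hi
    simpa [this] using hx i hi
  · exact (hx1 i hi).le

theorem tendsto_liftSimplex_dropLast_add {K : ℕ} (hK : 1 ≤ K) {θ : Fin K → ℝ}
    (hθ : ∑ i, θ i = 1) :
    Tendsto (fun x => liftSimplex K (dropLast K θ + x)) (𝓝 0) (𝓝 θ) := by
  have h : Continuous fun x => liftSimplex K (dropLast K θ + x) :=
    (continuous_liftSimplex K).comp (continuous_const_add _)
  simpa [liftSimplex_dropLast hK hθ] using h.tendsto 0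

/-- A function on the simplex with a nondegenerate strict global maximum gives a Laplace phase. -/
theorem isLaplacePhase_liftSimplex {K m : ℕ} (hm : m + 1 ≤ K) {G F : (Fin K → ℝ) → ℝ}
    {θ lam : Fin K → ℝ} {μ : ℝ} (hθ : θ ∈ stdSimplex ℝ (Fin K))
    (hzero : ∀ i : Fin K, θ i = 0 ↔ i.val < m)
    (hG : ContinuousOn G (stdSimplex ℝ (Fin K))) (hG0 : ∀ x ∈ stdSimplex ℝ (Fin K), 0 ≤ G x)
    (hG1 : ∀ x ∈ stdSimplex ℝ (Fin K), x ≠ θ → G x < 1)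
    (hGF : ∀ᶠ x in 𝓝 θ, G x = Real.exp (F x - F θ))
    (hF : ContDiffAt ℝ 2 F θ) (hlam : ∀ i : Fin K, ¬ i.val < m → lam i = 0)
    (hlampos : ∀ i : Fin K, i.val < m → 0 < lam i)
    (hgrad : ∀ i, gradVec F θ i = -lam i + μ) (hneg : IsNegDefOnCriticalCone F θ) :
    IsLaplacePhase (fun i : Fin (K - 1) => i.val < m) (shiftedSimplex K θ)
      (fun x => G (liftSimplex K (dropLast K θ + x)))
      (boundaryPhase (dropLast K lam) (interiorEquiv K m) (-reducedQ m F θ)) := by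
  have hK : 1 ≤ K := by omega
  have hmem : ∀ x ∈ shiftedSimplex K θ,
      liftSimplex K (dropLast K θ + x) ∈ stdSimplex ℝ (Fin K) := fun x hx =>
    (liftSimplex_mem_stdSimplex_iff hK).2 hx
  have hne : ∀ x : Fin (K - 1) → ℝ, x ≠ 0 → liftSimplex K (dropLast K θ + x) ≠ θ := by
    intro x hx h
    apply hx
    nth_rewrite 2 [← liftSimplex_dropLast hK hθ.2] at h
    simpa using liftSimplex_injective K h
  have hlt : ∀ x ∈ shiftedSimplex K θ, x ≠ 0 → G (liftSimplex K (dropLast K θ + x)) < 1 :=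
    fun x hx hx0 => hG1 _ (hmem x hx) (hne x hx0)
  have hone : G θ = 1 := by simpa using hGF.self_of_nhds
  have hcont : ContinuousOn (fun x => G (liftSimplex K (dropLast K θ + x)))
      (shiftedSimplex K θ) :=
    hG.comp ((continuous_liftSimplex K).comp (continuous_const_add _)).continuousOn hmem
  have htend := tendsto_liftSimplex_dropLast_add hK hθ.2
  refine ⟨hcont, fun x hx => hG0 _ (hmem x hx), fun x hx => ?_, fun U hU => ?_, ?_, ?_,
    isLeadingPhase_boundaryPhase (lam := dropLast K lam)
      (fun i hi => hlampos ⟨i.val, by omega⟩ hi) _ (posDef_neg_reducedQ hm hF hzero hneg)⟩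
  · by_cases hx0 : x = 0
    · rw [hx0, add_zero, liftSimplex_dropLast hK hθ.2, hone]
    · exact (hlt x hx hx0).le
  · obtain ⟨V, hVU, hVo, h0V⟩ := mem_nhds_iff.1 hU
    -- Uniform separation from $1$ comes from compactness: the maximum over the complement of a
    -- neighbourhood is attained at a point other than the origin.
    have hcomp : IsCompact (shiftedSimplex K θ \ V) := (isCompact_shiftedSimplex hK θ).diff hVo
    rcases (shiftedSimplex K θ \ V).eq_empty_or_nonempty with he | hne
    · refine ⟨0, one_pos, fun x hx => ?_⟩
      have : x ∈ shiftedSimplex K θ \ V := ⟨hx.1, fun h => hx.2 (hVU h)⟩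
      rw [he] at this
      exact this.elim
    · obtain ⟨z, hz, hmax⟩ := hcomp.exists_isMaxOn hne (hcont.mono Set.sdiff_subset)
      refine ⟨_, hlt z hz.1 (fun h => hz.2 (h ▸ h0V)), fun x hx => ?_⟩
      exact hmax ⟨hx.1, fun h => hx.2 (hVU h)⟩
  · refine mem_nhdsWithin_of_mem_nhds ?_
    filter_upwards [htend.eventually hGF] with x hx
    rw [hx]
    exact Real.exp_pos _
  · refine ((expansion_liftSimplex hm hF hθ.2 hlam hgrad).mono nhdsWithin_le_nhds).congr' ?_
      EventuallyEq.rfl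
    refine mem_nhdsWithin_of_mem_nhds ?_
    filter_upwards [htend.eventually hGF] with x hx
    rw [hx, Real.log_exp]

end Phases

/-! ### The Kullback-Leibler phase -/

section KL
variable {K : ℕ}

/-- Minus the Kullback-Leibler divergence, for vectors without relevant zeros. -/
noncomputable def negKL (p q : Fin K → ℝ) : ℝ := -∑ i, p i * Real.log (p i / q i)

/-- The exponential of minus the Kullback-Leibler divergence. -/
noncomputable def klFactor (p q : Fin K → ℝ) : ℝ := ∏ i, (q i / p i) ^ p i

theorem klFactor_eq_exp_negKL {p q : Fin K → ℝ} (hp : ∀ i, 0 ≤ p i) (hq : ∀ i, p i ≠ 0 → 0 < q i) :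
    klFactor p q = Real.exp (negKL p q) := by
  unfold klFactor negKL
  rw [← Finset.sum_neg_distrib, Real.exp_sum]
  refine Finset.prod_congr rfl fun i _ => ?_
  by_cases h : p i = 0
  · simp [h]
  · have hpi := lt_of_le_of_ne (hp i) (Ne.symm h)
    rw [Real.rpow_def_of_pos (div_pos (hq i h) hpi), ← inv_div (p i) (q i), Real.log_inv]
    ring_nf

/-- The product form has nonnegative exponents, so it stays continuous where some relevant
coordinate vanishes and the divergence blows up. -/
theorem continuous_klFactor {p : Fin K → ℝ} (hp : ∀ i, 0 ≤ p i) : Continuous (klFactor p) :=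
  continuous_finsetProd _ fun i _ =>
    ((continuous_apply i).div_const _).rpow_const fun _ => Or.inr (hp i)

theorem klFactor_nonneg {p q : Fin K → ℝ} (hp : ∀ i, 0 ≤ p i) (hq : ∀ i, 0 ≤ q i) :
    0 ≤ klFactor p q :=
  Finset.prod_nonneg fun i _ => Real.rpow_nonneg (div_nonneg (hq i) (hp i)) _

/-- Gibbs' inequality. -/
theorem klFactor_lt_one {p q : Fin K → ℝ} (hp : p ∈ stdSimplex ℝ (Fin K))
    (hq : q ∈ stdSimplex ℝ (Fin K)) (hpq : q ≠ p) : klFactor p q < 1 := by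
  by_cases h : ∀ i, p i ≠ 0 → 0 < q i
  · rw [klFactor_eq_exp_negKL hp.1 h, Real.exp_lt_one_iff]
    unfold negKL
    rw [← Finset.sum_neg_distrib]
    have hsum : ∑ i, (q i - p i) = 0 := by
      rw [Finset.sum_sub_distrib, hp.2, hq.2, sub_self]
    rw [← hsum]
    -- Termwise this is $\log t\le t-1$ at $t=q_i/p_i$, strict for $t\ne1$; the right-hand sides sum
    -- to zero.
    have hterm : ∀ i, -(p i * Real.log (p i / q i)) ≤ q i - p i ∧
        (q i ≠ p i → -(p i * Real.log (p i / q i)) < q i - p i) := by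
      intro i
      rcases (hp.1 i).eq_or_lt with h0 | h0
      · rw [← h0]
        simp only [zero_mul, neg_zero, sub_zero]
        exact ⟨hq.1 i, fun hne => lt_of_le_of_ne (hq.1 i) hne.symm⟩
      · have hqi := h i h0.ne'
        have hr : 0 < q i / p i := div_pos hqi h0
        have e1 : -(p i * Real.log (p i / q i)) = p i * Real.log (q i / p i) := by
          rw [← inv_div (q i) (p i), Real.log_inv]; ring
        have e2 : q i - p i = p i * (q i / p i - 1) := by field_simp
        rw [e1, e2]
        refine ⟨mul_le_mul_of_nonneg_left (Real.log_le_sub_one_of_pos hr) h0.le, fun hne => ?_⟩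
        refine mul_lt_mul_of_pos_left (Real.log_lt_sub_one_of_pos hr fun h1 => hne ?_) h0
        rwa [div_eq_one_iff_eq h0.ne'] at h1
    obtain ⟨i, hi⟩ := Function.ne_iff.1 hpq
    exact Finset.sum_lt_sum (fun i _ => (hterm i).1) ⟨i, Finset.mem_univ i, (hterm i).2 hi⟩
  · push Not at h
    obtain ⟨i, hi, hqi⟩ := h
    have hq0 : q i = 0 := le_antisymm hqi (hq.1 i)
    have : klFactor p q = 0 :=
      Finset.prod_eq_zero (Finset.mem_univ i) (by rw [hq0, zero_div, Real.zero_rpow hi])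
    rw [this]
    exact one_pos

theorem eventually_pos_of_ne_zero {p : Fin K → ℝ} (hp : ∀ i, 0 ≤ p i) :
    ∀ᶠ q in 𝓝 p, ∀ i, p i ≠ 0 → 0 < q i := by
  rw [eventually_all]
  intro i
  by_cases h : p i = 0
  · exact Eventually.of_forall fun q hq => (hq h).elim
  · have : 0 < p i := lt_of_le_of_ne (hp i) (Ne.symm h)
    exact ((continuous_apply i).continuousAt.eventually (lt_mem_nhds this)).mono fun q hq _ => hq

theorem negKL_self (p : Fin K → ℝ) : negKL p p = 0 := by
  unfold negKL
  rw [neg_eq_zero]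
  refine Finset.sum_eq_zero fun i _ => ?_
  by_cases h : p i = 0
  · simp [h]
  · simp [div_self h]

theorem hasDerivAt_neg_mul_log_div {c t : ℝ} (h : c ≠ 0 → t ≠ 0) :
    HasDerivAt (fun t => -(c * Real.log (c / t))) (c * t⁻¹) t := by
  by_cases hc : c = 0
  · simpa [hc] using hasDerivAt_const t (0 : ℝ)
  · have ht := h hc
    have h1 : HasDerivAt (fun t => c / t) (-c / t ^ 2) t := by
      simpa using (hasDerivAt_const t c).fun_div (hasDerivAt_id' t) ht
    have h2 := ((h1.log (div_ne_zero hc ht)).const_mul c).neg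
    convert! h2 using 1
    field_simp

theorem hasFDerivAt_negKL {p q : Fin K → ℝ} (hq : ∀ i, p i ≠ 0 → 0 < q i) :
    HasFDerivAt (negKL p)
      (∑ i, (p i * (q i)⁻¹) • (ContinuousLinearMap.proj i : (Fin K → ℝ) →L[ℝ] ℝ)) q := by
  have h : negKL p = fun q => ∑ i, -(p i * Real.log (p i / q i)) := by
    ext q; simp [negKL]
  rw [h]
  refine HasFDerivAt.fun_sum fun i _ => ?_
  have h1 := (hasDerivAt_neg_mul_log_div fun hc => (hq i hc).ne').comp_hasFDerivAt q
    (hasFDerivAt_apply (𝕜 := ℝ) i q)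
  exact h1

theorem contDiffAt_negKL {p : Fin K → ℝ} : ContDiffAt ℝ 2 (negKL p) p := by
  unfold negKL
  refine ContDiffAt.neg (ContDiffAt.sum fun i _ => ?_)
  by_cases h : p i = 0
  · simpa [h] using contDiffAt_const
  · refine contDiffAt_const.mul (ContDiffAt.log (contDiffAt_const.div ?_ h) ?_)
    · exact (contDiff_apply ℝ ℝ i).contDiffAt
    · simp [h]

/-- The partial derivative $p_i/q_i$ at $q=p$ is $1$ on the support and $0$ off it. In KKT form this
is $\mu=1$ with multiplier $1$ at every zero coordinate, the source of the $1$ in $\lambda_k+1$. -/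
theorem gradVec_negKL {p : Fin K → ℝ} (hp : ∀ i, 0 ≤ p i) (i : Fin K) :
    gradVec (negKL p) p i = -(if p i = 0 then 1 else 0) + 1 := by
  have hq : ∀ i, p i ≠ 0 → 0 < p i := fun i h => lt_of_le_of_ne (hp i) (Ne.symm h)
  unfold gradVec
  rw [(hasFDerivAt_negKL hq).fderiv]
  simp only [sum_apply, FunLike.coe_smul, Pi.smul_apply,
    ContinuousLinearMap.proj_apply, smul_eq_mul, Pi.single_apply, mul_ite, mul_one, mul_zero,
    Finset.sum_ite_eq', Finset.mem_univ, if_true]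
  by_cases h : p i = 0
  · simp [h]
  · simp [h]

theorem hasFDerivAt_fderiv_negKL {p : Fin K → ℝ} (hp : ∀ i, 0 ≤ p i) :
    HasFDerivAt (fderiv ℝ (negKL p))
      (∑ i, ((p i * -(p i ^ 2)⁻¹) • (ContinuousLinearMap.proj i : (Fin K → ℝ) →L[ℝ] ℝ)).smulRight
        (ContinuousLinearMap.proj i : (Fin K → ℝ) →L[ℝ] ℝ)) p := by
  have hev : fderiv ℝ (negKL p) =ᶠ[𝓝 p] fun q =>
      ∑ i, (p i * (q i)⁻¹) • (ContinuousLinearMap.proj i : (Fin K → ℝ) →L[ℝ] ℝ) :=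
    (eventually_pos_of_ne_zero hp).mono fun q hq => (hasFDerivAt_negKL hq).fderiv
  refine HasFDerivAt.congr_of_eventuallyEq ?_ hev
  refine HasFDerivAt.fun_sum fun i _ => ?_
  have h : HasFDerivAt (fun q : Fin K → ℝ => p i * (q i)⁻¹)
      ((p i * -(p i ^ 2)⁻¹) • (ContinuousLinearMap.proj i : (Fin K → ℝ) →L[ℝ] ℝ)) p := by
    by_cases h : p i = 0
    · simpa [h] using hasFDerivAt_const (0 : ℝ) p
    · have h1 := ((hasDerivAt_inv h).const_mul (p i)).comp_hasFDerivAt p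
        (hasFDerivAt_apply (𝕜 := ℝ) i p)
      exact h1
  exact h.smul_const (ContinuousLinearMap.proj i : (Fin K → ℝ) →L[ℝ] ℝ)

/-- The Hessian is diagonal with entries $-1/p_i$ on the support, and directions of the critical
cone are supported there. -/
theorem isNegDefOnCriticalCone_negKL {p : Fin K → ℝ} (hp : ∀ i, 0 ≤ p i) :
    IsNegDefOnCriticalCone (negKL p) p := by
  intro d hd hd0
  rw [← fderiv_fderiv_eq_hessMat, (hasFDerivAt_fderiv_negKL hp).fderiv]
  have hval : (∑ i, ((p i * -(p i ^ 2)⁻¹) •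
      (ContinuousLinearMap.proj i : (Fin K → ℝ) →L[ℝ] ℝ)).smulRight
        (ContinuousLinearMap.proj i : (Fin K → ℝ) →L[ℝ] ℝ)) d d = ∑ i, -((p i)⁻¹ * d i ^ 2) := by
    simp only [sum_apply]
    refine Finset.sum_congr rfl fun i _ => ?_
    by_cases h : p i = 0
    · simp [h]
    · simp
      field_simp
  rw [hval]
  obtain ⟨i, hi⟩ := Function.ne_iff.1 hd0
  have hpi : 0 < p i := lt_of_le_of_ne (hp i) fun h => hi (hd.2 i h.symm)
  refine Finset.sum_neg' (fun i _ => ?_) ⟨i, Finset.mem_univ i, ?_⟩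
  · exact neg_nonpos.2 (mul_nonneg (inv_nonneg.2 (hp i)) (sq_nonneg _))
  · exact neg_neg_of_pos (mul_pos (inv_pos.2 hpi) (by simpa using sq_pos_of_ne_zero hi))

theorem klVec_toReal_eventuallyEq {p : Fin K → ℝ} (hp : ∀ i, 0 ≤ p i) :
    (fun q => (klVec p q).toReal) =ᶠ[𝓝 p] fun q => -negKL p q := by
  filter_upwards [eventually_pos_of_ne_zero hp] with q hq
  unfold klVec
  rw [if_neg (by push Not; exact hq)]
  simp [negKL]

/-- Near `p` the divergence is finite and equals `-negKL p`, so the second derivatives agree and `R`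
can be treated as the reduced Hessian of an objective. -/
theorem reducedR_eq_reducedQ_negKL {m : ℕ} {p : Fin K → ℝ} (hp : ∀ i, 0 ≤ p i) :
    reducedR m p = reducedQ m (negKL p) p := by
  have h : hessMat (fun q => (klVec p q).toReal) p = -hessMat (negKL p) p := by
    have h1 := (klVec_toReal_eventuallyEq hp).fderiv (𝕜 := ℝ)
    have h2 : fderiv ℝ (fun q => -negKL p q) = fun q => -fderiv ℝ (negKL p) q := by
      ext1 q; exact fderiv_fun_neg
    rw [h2] at h1
    ext i j
    simp only [hessMat, Matrix.of_apply, h1.fderiv_eq, Matrix.neg_apply]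
    rw [fderiv_fun_neg]
    rfl
  unfold reducedR reducedQ
  rw [h]
  simp

/-- Where the divergence is infinite both sides vanish: the left by $e^{-\infty}=0$, the right
because a factor is $0$ and $n>0$. -/
theorem controlVariate_eq {H : (Fin K → ℝ) → ℝ} {p q : Fin K → ℝ} (hp : ∀ i, 0 ≤ p i)
    (hq : ∀ i, 0 ≤ q i) {n : ℝ} (hn : 0 < n) :
    controlVariate H p n q = Real.exp (n * H p) * klFactor p q ^ n := by
  unfold controlVariate hatH klVec
  by_cases h : ∃ i, p i ≠ 0 ∧ q i ≤ 0
  · obtain ⟨i, hi, hqi⟩ := h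
    have hq0 : q i = 0 := le_antisymm hqi (hq i)
    have hk : klFactor p q = 0 :=
      Finset.prod_eq_zero (Finset.mem_univ i) (by rw [hq0, zero_div, Real.zero_rpow hi])
    rw [if_pos ⟨i, hi, hqi⟩, hk, Real.zero_rpow hn.ne', mul_zero, EReal.sub_top,
      EReal.coe_mul_bot_of_pos hn]
    simp
  · rw [if_neg h]
    push Not at h
    rw [klFactor_eq_exp_negKL hp h, ← Real.exp_mul, ← Real.exp_add, ← EReal.coe_sub,
      ← EReal.coe_mul, EReal.exp_coe, ENNReal.toReal_ofReal (Real.exp_nonneg _)]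
    congr 1
    unfold negKL
    ring

end KL

/-! ### Laplace's method under the Dirichlet distribution -/

section DirichletMeasure
variable {K : ℕ}

theorem prod_eq_prod_dropLast_mul (hK : 1 ≤ K) (f : Fin K → ℝ) :
    ∏ i, f i = (∏ j, dropLast K f j) * f ⟨K - 1, by omega⟩ := by
  obtain ⟨k, rfl⟩ : ∃ k, K = k + 1 := ⟨K - 1, by omega⟩
  exact Fin.prod_univ_castSucc f

theorem multiBeta_pos (hK : 1 ≤ K) {α : Fin K → ℝ} (hα : ∀ i, 0 < α i) : 0 < multiBeta α := by
  have : Nonempty (Fin K) := ⟨⟨0, hK⟩⟩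
  exact div_pos (Finset.prod_pos fun i _ => Real.Gamma_pos_of_pos (hα i))
    (Real.Gamma_pos_of_pos (Finset.sum_pos (fun i _ => hα i) Finset.univ_nonempty))

theorem dirichletDensity_nonneg (hK : 1 ≤ K) {α θ : Fin K → ℝ} (hα : ∀ i, 0 < α i)
    (hθ : ∀ i, 0 ≤ θ i) : 0 ≤ dirichletDensity α θ :=
  mul_nonneg (one_div_nonneg.2 (multiBeta_pos hK hα).le)
    (Finset.prod_nonneg fun i _ => Real.rpow_nonneg (hθ i) _)

theorem measurable_dirichletDensity (α : Fin K → ℝ) :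
    Measurable fun y => dirichletDensity α (liftSimplex K y) := by
  unfold dirichletDensity
  refine (Finset.measurable_prod _ fun i _ => ?_).const_mul _
  exact ((measurable_pi_apply i).comp (continuous_liftSimplex K).measurable).pow_const _

theorem integrableOn_dirichletDensity (hK : 1 ≤ K) {α : Fin K → ℝ} (hα : ∀ i, 0 < α i) :
    IntegrableOn (fun y => dirichletDensity α (liftSimplex K y)) (projSimplex K) :=
  (integrableOn_prod_liftSimplex hK hα).const_mul _

theorem isFiniteMeasure_dirichletMeasure (hK : 1 ≤ K) {α : Fin K → ℝ} (hα : ∀ i, 0 < α i) :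
    IsFiniteMeasure (dirichletMeasure α) := by
  have : IsFiniteMeasure ((volume.restrict (projSimplex K)).withDensity
      fun y => ENNReal.ofReal (dirichletDensity α (liftSimplex K y))) :=
    isFiniteMeasure_withDensity_ofReal (integrableOn_dirichletDensity hK hα).2
  unfold dirichletMeasure
  infer_instance

theorem ae_dirichletMeasure_mem_stdSimplex (hK : 1 ≤ K) (α : Fin K → ℝ) :
    ∀ᵐ θ ∂dirichletMeasure α, θ ∈ stdSimplex ℝ (Fin K) := by
  unfold dirichletMeasure
  rw [(measurableEmbedding_liftSimplex K).ae_map_iff]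
  refine (withDensity_absolutelyContinuous _ _).ae_le ?_
  filter_upwards [ae_restrict_mem (measurableSet_projSimplex K)] with y hy
  exact (liftSimplex_mem_stdSimplex_iff hK).2 hy

theorem ContinuousOn.aestronglyMeasurable_dirichletMeasure (hK : 1 ≤ K) (α : Fin K → ℝ)
    {f : (Fin K → ℝ) → ℝ} (hf : ContinuousOn f (stdSimplex ℝ (Fin K))) :
    AEStronglyMeasurable f (dirichletMeasure α) := by
  unfold dirichletMeasure
  rw [(measurableEmbedding_liftSimplex K).aestronglyMeasurable_map_iff]
  refine AEStronglyMeasurable.mono_ac (withDensity_absolutelyContinuous _ _) ?_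
  refine ContinuousOn.aestronglyMeasurable ?_ (measurableSet_projSimplex K)
  exact hf.comp (continuous_liftSimplex K).continuousOn
    fun y hy => (liftSimplex_mem_stdSimplex_iff hK).2 hy

theorem integral_dirichletMeasure (hK : 1 ≤ K) {α : Fin K → ℝ} (hα : ∀ i, 0 < α i)
    (θ : Fin K → ℝ) (f : (Fin K → ℝ) → ℝ) :
    ∫ x, f x ∂dirichletMeasure α = ∫ x in shiftedSimplex K θ,
      f (liftSimplex K (dropLast K θ + x)) *
        dirichletDensity α (liftSimplex K (dropLast K θ + x)) := by
  unfold dirichletMeasure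
  rw [(measurableEmbedding_liftSimplex K).integral_map,
    integral_withDensity_eq_integral_toReal_smul (measurable_dirichletDensity α).ennreal_ofReal
      (ae_of_all _ fun y => ENNReal.ofReal_lt_top)]
  have h := (measurePreserving_add_left volume (dropLast K θ)).setIntegral_preimage_emb
    (measurableEmbedding_addLeft (dropLast K θ))
    (fun y => f (liftSimplex K y) * dirichletDensity α (liftSimplex K y)) (projSimplex K)
  refine Eq.trans ?_ h.symm
  refine setIntegral_congr_fun (measurableSet_projSimplex K) fun y hy => ?_
  have h0 := dirichletDensity_nonneg hK hα ((liftSimplex_mem_stdSimplex_iff hK).2 hy).1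
  simp only [ENNReal.toReal_ofReal h0, smul_eq_mul, mul_comm]

/-- The factor of the Dirichlet density that stays regular near a point whose first `m` coordinates
vanish. -/
noncomputable def regularDensity (m : ℕ) (α θ : Fin K → ℝ) : ℝ :=
  1 / multiBeta α * ∏ i : Fin K, if i.val < m then 1 else θ i ^ (α i - 1)

/-- The factors that may be singular at `θ` are those of its zero coordinates, where the lifted
point has coordinate `x i` itself; they form the weight of the Laplace integral. The last coordinate
belongs to the regular factor. -/
theorem dirichletDensity_eq {m : ℕ} (hm : m + 1 ≤ K) {θ : Fin K → ℝ}
    (hzero : ∀ i : Fin K, θ i = 0 ↔ i.val < m) (α : Fin K → ℝ) (x : Fin (K - 1) → ℝ) :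
    dirichletDensity α (liftSimplex K (dropLast K θ + x)) =
      boundaryWeight (fun i : Fin (K - 1) => i.val < m) (dropLast K α) x *
        regularDensity m α (liftSimplex K (dropLast K θ + x)) := by
  have h1 : boundaryWeight (fun i : Fin (K - 1) => i.val < m) (dropLast K α) x =
      ∏ i : Fin K, if i.val < m then liftSimplex K (dropLast K θ + x) i ^ (α i - 1) else 1 := by
    rw [prod_eq_prod_dropLast_mul (by omega), if_neg (by simp; omega), mul_one]
    refine Finset.prod_congr rfl fun i _ => ?_
    have hi : i.val < K - 1 := i.isLt
    simp only [dropLast]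
    split_ifs with h
    · have : dropLast K θ i = 0 := (hzero _).2 h
      simp [liftSimplex, this]
    · rfl
  unfold dirichletDensity regularDensity
  rw [h1, mul_left_comm, ← Finset.prod_mul_distrib]
  congr 1
  refine Finset.prod_congr rfl fun i _ => ?_
  split_ifs <;> simp

theorem regularDensity_pos (hK : 1 ≤ K) {m : ℕ} {α θ : Fin K → ℝ} (hα : ∀ i, 0 < α i)
    (hθ : ∀ i : Fin K, ¬ i.val < m → 0 < θ i) : 0 < regularDensity m α θ := by
  refine mul_pos (one_div_pos.2 (multiBeta_pos hK hα)) (Finset.prod_pos fun i _ => ?_)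
  split_ifs with h
  · exact one_pos
  · exact Real.rpow_pos_of_pos (hθ i h) _

theorem continuousAt_regularDensity {m : ℕ} (α : Fin K → ℝ) {θ : Fin K → ℝ}
    (hθ : ∀ i : Fin K, ¬ i.val < m → 0 < θ i) : ContinuousAt (regularDensity m α) θ := by
  unfold regularDensity
  refine continuousAt_const.mul (tendsto_finsetProd _ fun i _ => ?_)
  split_ifs with h
  · exact tendsto_const_nhds
  · exact ((continuous_apply i).continuousAt).rpow_const (Or.inl (hθ i h).ne')

theorem measurable_regularDensity (m : ℕ) (α : Fin K → ℝ) : Measurable (regularDensity m α) := by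
  unfold regularDensity
  refine (Finset.measurable_prod _ fun i _ => ?_).const_mul _
  split_ifs
  · exact measurable_const
  · exact (measurable_pi_apply i).pow_const _

/-- Laplace's method under the Dirichlet distribution. -/
theorem IsLaplacePhase.tendsto_integral_dirichletMeasure {m : ℕ} (hm : m + 1 ≤ K)
    {α θ : Fin K → ℝ} (hα : ∀ i, 0 < α i) (hθ : θ ∈ stdSimplex ℝ (Fin K))
    (hzero : ∀ i : Fin K, θ i = 0 ↔ i.val < m)
    {G : (Fin K → ℝ) → ℝ} {ℓ : (Fin (K - 1) → ℝ) → ℝ}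
    (h : IsLaplacePhase (fun i : Fin (K - 1) => i.val < m) (shiftedSimplex K θ)
      (fun x => G (liftSimplex K (dropLast K θ + x))) ℓ) :
    Tendsto (fun n : ℝ => n ^ laplaceExponent (fun i : Fin (K - 1) => i.val < m) (dropLast K α) *
        ∫ x, G x ^ n ∂dirichletMeasure α) atTop
      (𝓝 (regularDensity m α θ *
        laplaceLimit (fun i : Fin (K - 1) => i.val < m) (dropLast K α) ℓ)) := by
  have hK : 1 ≤ K := by omega
  have hpos : ∀ i : Fin K, ¬ i.val < m → 0 < θ i := fun i hi =>
    lt_of_le_of_ne (hθ.1 i) fun h => hi ((hzero i).1 h.symm)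
  have hc : Continuous fun x => liftSimplex K (dropLast K θ + x) :=
    (continuous_liftSimplex K).comp (continuous_const_add _)
  have h0 : liftSimplex K (dropLast K θ + 0) = θ := by
    rw [add_zero, liftSimplex_dropLast hK hθ.2]
  have key := h.tendsto_setIntegral (a := dropLast K α)
    (g := fun x => regularDensity m α (liftSimplex K (dropLast K θ + x)))
    (isCompact_shiftedSimplex hK θ).measurableSet (shiftedSimplex_subset hzero)
    (shiftedSimplex_eventually hm hθ hzero) (fun i _ => hα _)
    ((measurable_regularDensity m α).comp hc.measurable) ?_ ?_
  · simp only [h0] at key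
    refine key.congr fun n => ?_
    rw [integral_dirichletMeasure hK hα θ]
    simp only [dirichletDensity_eq hm hzero]
  · have : ContinuousAt (regularDensity m α) (liftSimplex K (dropLast K θ + 0)) := by
      rw [h0]; exact continuousAt_regularDensity α hpos
    exact this.comp (f := fun x => liftSimplex K (dropLast K θ + x)) hc.continuousAt
  · simp only [← dirichletDensity_eq hm hzero]
    exact ((measurePreserving_add_left volume (dropLast K θ)).integrableOn_comp_preimage
      (measurableEmbedding_addLeft (dropLast K θ))).2 (integrableOn_dirichletDensity hK hα)

end DirichletMeasure

/-! ### Asymptotics of covariances -/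

section Covariance

/-- The factor $2-\mu(\Omega)$ comes from integrating the constant $ab$; it is $1$ for a probability
measure. Allowing any finite mass makes it unnecessary to evaluate the Dirichlet normalization. -/
theorem covariance_eq_integral_sub {Ω : Type*} [MeasurableSpace Ω] {μ : Measure Ω}
    [IsFiniteMeasure μ] {X Y : Ω → ℝ} (hX : Integrable X μ) (hY : Integrable Y μ)
    (hXY : Integrable (fun ω => X ω * Y ω) μ) :
    covariance X Y μ =
      ∫ ω, X ω * Y ω ∂μ - (2 - μ.real Set.univ) * ((∫ ω, X ω ∂μ) * ∫ ω, Y ω ∂μ) := by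
  unfold covariance
  set a := ∫ ω, X ω ∂μ with ha
  set b := ∫ ω, Y ω ∂μ with hb
  have h : ∀ ω, (X ω - a) * (Y ω - b) = X ω * Y ω - (b * X ω + a * Y ω) + a * b := fun ω => by ring
  simp_rw [h]
  have h1 : Integrable (fun ω => b * X ω + a * Y ω) μ := (hX.const_mul b).add (hY.const_mul a)
  have h2 : Integrable (fun ω => X ω * Y ω - (b * X ω + a * Y ω)) μ := hXY.sub h1
  rw [integral_add h2 (integrable_const _), integral_sub hXY h1, integral_add (hX.const_mul b) (hY.const_mul a), integral_const_mul, integral_const_mul,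
    integral_const, ← ha, ← hb, smul_eq_mul]
  ring

theorem correlation_const_mul {Ω : Type*} [MeasurableSpace Ω] {μ : Measure Ω} {X Y : Ω → ℝ}
    {c d : ℝ} (hc : 0 < c) (hd : 0 < d) :
    correlation (fun ω => c * X ω) (fun ω => d * Y ω) μ = correlation X Y μ := by
  unfold correlation
  rw [covariance_const_mul_left, covariance_const_mul_right, variance_const_mul,
    variance_const_mul]
  have h : c ^ 2 * variance X μ * (d ^ 2 * variance Y μ) =
      (c * d) ^ 2 * (variance X μ * variance Y μ) := by ring
  rw [h, Real.sqrt_mul (sq_nonneg _), Real.sqrt_sq (by positivity), ← mul_assoc,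
    mul_div_mul_left _ _ (by positivity)]

theorem correlation_sq {Ω : Type*} [MeasurableSpace Ω] {μ : Measure Ω} {X Y : Ω → ℝ}
    (hX : AEMeasurable X μ) (hY : AEMeasurable Y μ) :
    correlation X Y μ ^ 2 =
      covariance X Y μ ^ 2 / (covariance X X μ * covariance Y Y μ) := by
  unfold correlation
  rw [div_pow, Real.sq_sqrt (mul_nonneg (variance_nonneg _ _) (variance_nonneg _ _)),
    covariance_self hX, covariance_self hY]

theorem correlation_congr {Ω : Type*} [MeasurableSpace Ω] {μ : Measure Ω} {X Y X' Y' : Ω → ℝ}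
    (hX : X =ᵐ[μ] X') (hY : Y =ᵐ[μ] Y') : correlation X Y μ = correlation X' Y' μ := by
  unfold correlation
  rw [variance_congr hX, variance_congr hY]
  congr 1
  unfold covariance
  rw [integral_congr_ae hX, integral_congr_ae hY]
  refine integral_congr_ae ?_
  filter_upwards [hX, hY] with ω h1 h2
  rw [h1, h2]

variable {K : ℕ}

theorem integrable_rpow_dirichletMeasure (hK : 1 ≤ K) {α : Fin K → ℝ} (hα : ∀ i, 0 < α i)
    {G : (Fin K → ℝ) → ℝ} (hG : ContinuousOn G (stdSimplex ℝ (Fin K)))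
    {n : ℝ} (hn : 0 < n) : Integrable (fun x => G x ^ n) (dirichletMeasure α) := by
  have := isFiniteMeasure_dirichletMeasure hK hα
  have hGn : ContinuousOn (fun x => G x ^ n) (stdSimplex ℝ (Fin K)) :=
    hG.rpow_const fun _ _ => Or.inr hn.le
  obtain ⟨C, hC⟩ := (isCompact_stdSimplex ℝ (Fin K)).exists_bound_of_continuousOn hGn
  refine Integrable.of_bound (hGn.aestronglyMeasurable_dirichletMeasure hK α) C ?_
  filter_upwards [ae_dirichletMeasure_mem_stdSimplex hK α] with x hx using hC x hx

theorem laplaceExponent_pos {m : ℕ} (hm : m + 2 ≤ K) {α : Fin K → ℝ} (hα : ∀ i, 0 < α i) :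
    0 < laplaceExponent (fun i : Fin (K - 1) => i.val < m) (dropLast K α) := by
  have : Nonempty (Fin (K - 1)) := ⟨⟨0, by omega⟩⟩
  refine Finset.sum_pos (fun i _ => ?_) Finset.univ_nonempty
  split_ifs
  · exact hα _
  · norm_num

/-- The covariances of powers of two Laplace phases are dominated by the mixed second moments. -/
theorem tendsto_covariance_dirichletMeasure {m : ℕ} (hm : m + 2 ≤ K)
    {α θ : Fin K → ℝ} (hα : ∀ i, 0 < α i) (hθ : θ ∈ stdSimplex ℝ (Fin K))
    (hzero : ∀ i : Fin K, θ i = 0 ↔ i.val < m)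
    {G G' : (Fin K → ℝ) → ℝ} {ℓ ℓ' : (Fin (K - 1) → ℝ) → ℝ}
    (hG : ContinuousOn G (stdSimplex ℝ (Fin K))) (hG0 : ∀ x ∈ stdSimplex ℝ (Fin K), 0 ≤ G x)
    (hG' : ContinuousOn G' (stdSimplex ℝ (Fin K))) (hG0' : ∀ x ∈ stdSimplex ℝ (Fin K), 0 ≤ G' x)
    (h : IsLaplacePhase (fun i : Fin (K - 1) => i.val < m) (shiftedSimplex K θ)
      (fun x => G (liftSimplex K (dropLast K θ + x))) ℓ)
    (h' : IsLaplacePhase (fun i : Fin (K - 1) => i.val < m) (shiftedSimplex K θ)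
      (fun x => G' (liftSimplex K (dropLast K θ + x))) ℓ') :
    Tendsto (fun n : ℝ => n ^ laplaceExponent (fun i : Fin (K - 1) => i.val < m) (dropLast K α) *
        covariance (fun x => G x ^ n) (fun x => G' x ^ n) (dirichletMeasure α)) atTop
      (𝓝 (regularDensity m α θ * laplaceLimit (fun i : Fin (K - 1) => i.val < m) (dropLast K α)
        fun x => ℓ x + ℓ' x)) := by
  have hK : 1 ≤ K := by omega
  have := isFiniteMeasure_dirichletMeasure hK hα
  set τ := laplaceExponent (fun i : Fin (K - 1) => i.val < m) (dropLast K α) with hτ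
  have hτ0 : 0 < τ := laplaceExponent_pos hm hα
  have t1 := h.tendsto_integral_dirichletMeasure (by omega) hα hθ hzero
  have t2 := h'.tendsto_integral_dirichletMeasure (by omega) hα hθ hzero
  have t3 := IsLaplacePhase.tendsto_integral_dirichletMeasure (G := fun x => G x * G' x)
    (by omega) hα hθ hzero (h.mul h')
  -- The product of the two means has order $n^{-2\tau}$, which leaves a factor $n^{-\tau}$ after
  -- normalization by $n^\tau$.
  have t4 : Tendsto (fun n : ℝ => n ^ (-τ)) atTop (𝓝 0) := tendsto_rpow_neg_atTop hτ0
  have t5 := t3.sub (((t1.mul t2).mul t4).const_mul (2 - (dirichletMeasure α).real Set.univ))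
  rw [mul_zero, mul_zero, sub_zero] at t5
  refine t5.congr' ?_
  filter_upwards [eventually_gt_atTop 0] with n hn
  have hmul : (fun x => G x ^ n * G' x ^ n) =ᵐ[dirichletMeasure α] fun x => (G x * G' x) ^ n := by
    filter_upwards [ae_dirichletMeasure_mem_stdSimplex hK α] with x hx
    rw [Real.mul_rpow (hG0 x hx) (hG0' x hx)]
  rw [covariance_eq_integral_sub (integrable_rpow_dirichletMeasure hK hα hG hn)
    (integrable_rpow_dirichletMeasure hK hα hG' hn)
    ((integrable_rpow_dirichletMeasure hK hα (hG.mul hG') hn).congr hmul.symm),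
    integral_congr_ae hmul]
  have hn1 : n ^ τ * n ^ (-τ) = 1 := by
    rw [← Real.rpow_add hn, add_neg_cancel, Real.rpow_zero]
  simp only [← hτ]
  linear_combination (-(2 - (dirichletMeasure α).real Set.univ) * n ^ τ *
    (∫ x, G x ^ n ∂dirichletMeasure α) * ∫ x, G' x ^ n ∂dirichletMeasure α) * hn1

end Covariance

/-! ### Evaluation of the limiting constants -/

section Constants

theorem gamma_factor_ratio {a l : ℝ} (ha : 0 < a) (hl : 0 < l) :
    ((1 / (l + 1)) ^ a * Real.Gamma a) ^ 2 /
      ((1 / (l + l)) ^ a * Real.Gamma a * ((1 / (1 + 1)) ^ a * Real.Gamma a)) =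
      (4 * l / (l + 1) ^ 2) ^ a := by
  have hΓ : Real.Gamma a ≠ 0 := (Real.Gamma_pos_of_pos ha).ne'
  have h1 : ((1 / (l + 1)) ^ a * Real.Gamma a) ^ 2 =
      ((1 / (l + 1)) * (1 / (l + 1))) ^ a * Real.Gamma a ^ 2 := by
    rw [Real.mul_rpow (by positivity) (by positivity)]; ring
  have h2 : (1 / (l + l)) ^ a * Real.Gamma a * ((1 / (1 + 1)) ^ a * Real.Gamma a) =
      ((1 / (l + l)) * (1 / (1 + 1))) ^ a * Real.Gamma a ^ 2 := by
    rw [Real.mul_rpow (by positivity) (by positivity)]; ring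
  rw [h1, h2, mul_div_mul_right _ _ (pow_ne_zero 2 hΓ),
    ← Real.div_rpow (by positivity) (by positivity)]
  congr 1
  field_simp
  ring

/-- Doubling a $d\times d$ matrix multiplies its determinant by $2^d$. The two square roots of $2^d$
from `M + M` and `N + N` make up the $2^d$ from halving $Q+R$, and signs vanish under absolute
values. -/
theorem det_factor_ratio {d : ℕ} {M N : Matrix (Fin d) (Fin d) ℝ} (hM : M.PosDef) (hN : N.PosDef) :
    ((Real.sqrt (M + N).det)⁻¹) ^ 2 /
      ((Real.sqrt (M + M).det)⁻¹ * (Real.sqrt (N + N).det)⁻¹) =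
      Real.sqrt |(-M).det| * Real.sqrt |(-N).det| /
        |((1 / 2 : ℝ) • (-M + -N)).det| := by
  have hMN : 0 < (M + N).det := (hM.add hN).det_pos
  have h2 : ∀ A : Matrix (Fin d) (Fin d) ℝ, (A + A).det = 2 ^ d * A.det := fun A => by
    rw [← two_smul ℝ A, Matrix.det_smul, Fintype.card_fin]
  have h3 : ∀ A : Matrix (Fin d) (Fin d) ℝ, |(-A).det| = |A.det| := fun A => by
    rw [Matrix.det_neg, abs_mul, abs_pow, abs_neg, abs_one, one_pow, one_mul]
  have h4 : |((1 / 2 : ℝ) • (-M + -N)).det| = (2 ^ d)⁻¹ * (M + N).det := by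
    rw [← neg_add, Matrix.det_smul, abs_mul, h3, Fintype.card_fin, abs_of_pos hMN,
      abs_of_pos (by positivity), one_div, inv_pow]
  have h5 : Real.sqrt (2 ^ d) * Real.sqrt (2 ^ d) = 2 ^ d := Real.mul_self_sqrt (by positivity)
  have h6 : Real.sqrt (M + N).det ^ 2 = (M + N).det := Real.sq_sqrt hMN.le
  have h7 := Real.sqrt_pos.2 hM.det_pos
  have h8 := Real.sqrt_pos.2 hN.det_pos
  rw [h3, h3, h4, h2, h2, abs_of_pos hM.det_pos, abs_of_pos hN.det_pos, inv_pow, h6,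
    Real.sqrt_mul (by positivity), Real.sqrt_mul (by positivity)]
  have h9 : (0 : ℝ) < Real.sqrt (2 ^ d) := Real.sqrt_pos.2 (by positivity)
  field_simp
  rw [sq, h5]

end Constants

/-! ### The limit of the squared correlation -/

theorem theorem5 (K m : ℕ) (hm : m + 2 ≤ K)
    (α : Fin K → ℝ) (hα : ∀ i, 0 < α i)
    (H : (Fin K → ℝ) → ℝ) (θs lam : Fin K → ℝ)
    (hmax : IsUniqueSimplexMax H θs)
    (hreg : IsRegularAt H θs)
    (hzero : ∀ i : Fin K, θs i = 0 ↔ i.val < m)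
    (hkkt : IsKKTMultiplier H θs lam)
    (hstrict : ∀ i : Fin K, i.val < m → 0 < lam i)
    (hneg : IsNegDefOnCriticalCone H θs) :
    Tendsto (fun n : ℝ => rhoCV α H θs n ^ 2) atTop
      (𝓝 (Real.sqrt |(reducedQ m H θs).det| * Real.sqrt |(reducedR m θs).det| /
            |((1 / 2 : ℝ) • (reducedQ m H θs + reducedR m θs)).det| *
          ∏ k : Fin K with k.val < m, (4 * lam k / (lam k + 1) ^ 2) ^ α k)) := by
  obtain ⟨hθ, hH1⟩ := hmax
  obtain ⟨hHc, V, hVo, hθV, hHV⟩ := hreg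
  obtain ⟨-, hcompl, μ, hgrad⟩ := hkkt
  have hK : 1 ≤ K := by omega
  have hm1 : m + 1 ≤ K := by omega
  have hH2 : ContDiffAt ℝ 2 H θs := hHV.contDiffAt (hVo.mem_nhds hθV)
  have hlam : ∀ i : Fin K, ¬ i.val < m → lam i = 0 := fun i hi =>
    (mul_eq_zero.1 (hcompl i)).resolve_right fun h => hi ((hzero i).1 h)
  have := isFiniteMeasure_dirichletMeasure hK hα
  -- the two normalized random variables
  let G : (Fin K → ℝ) → ℝ := fun x => Real.exp (H x - H θs)
  -- The KKT multipliers of $-\mathrm{KL}$ at $\theta^*$, as computed in `gradVec_negKL`.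
  let one' : Fin K → ℝ := fun i => if θs i = 0 then 1 else 0
  have hGc : ContinuousOn G (stdSimplex ℝ (Fin K)) :=
    (hHc.sub continuousOn_const).rexp
  have hG0 : ∀ x ∈ stdSimplex ℝ (Fin K), 0 ≤ G x := fun x _ => Real.exp_nonneg _
  have hLc : ContinuousOn (klFactor θs) (stdSimplex ℝ (Fin K)) :=
    (continuous_klFactor hθ.1).continuousOn
  have hL0 : ∀ x ∈ stdSimplex ℝ (Fin K), 0 ≤ klFactor θs x := fun x hx =>
    klFactor_nonneg hθ.1 hx.1
  have phG := isLaplacePhase_liftSimplex (G := G) hm1 hθ hzero hGc hG0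
    (fun x hx hne => by
      have := hH1 x hx hne
      exact Real.exp_lt_one_iff.2 (by linarith))
    (Eventually.of_forall fun x => rfl) hH2 hlam hstrict hgrad hneg
  have phL := isLaplacePhase_liftSimplex (G := klFactor θs) (lam := one') hm1 hθ hzero hLc hL0
    (fun x hx hne => klFactor_lt_one hθ hx hne)
    ((eventually_pos_of_ne_zero hθ.1).mono fun q hq => by
      rw [klFactor_eq_exp_negKL hθ.1 hq, negKL_self, sub_zero])
    contDiffAt_negKL (fun i hi => if_neg fun h => hi ((hzero i).1 h))
    (fun i hi => by simp [one', (hzero i).2 hi]) (gradVec_negKL hθ.1)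
    (isNegDefOnCriticalCone_negKL hθ.1)
  have pdQ := posDef_neg_reducedQ hm1 hH2 hzero hneg
  have pdR := posDef_neg_reducedQ hm1 contDiffAt_negKL hzero (isNegDefOnCriticalCone_negKL hθ.1)
  rw [← reducedR_eq_reducedQ_negKL hθ.1] at phL pdR
  set M := -reducedQ m H θs with hM
  set N := -reducedR m θs with hN
  set τ := laplaceExponent (fun i : Fin (K - 1) => i.val < m) (dropLast K α) with hτ
  have cGL := tendsto_covariance_dirichletMeasure hm hα hθ hzero hGc hG0 hLc hL0 phG phL
  have cGG := tendsto_covariance_dirichletMeasure hm hα hθ hzero hGc hG0 hGc hG0 phG phG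
  have cLL := tendsto_covariance_dirichletMeasure hm hα hθ hzero hLc hL0 hLc hL0 phL phL
  have hlb : ∀ i : Fin (K - 1), i.val < m → 0 < dropLast K lam i :=
    fun i hi => hstrict ⟨i.val, by omega⟩ hi
  have h1b : ∀ i : Fin (K - 1), i.val < m → dropLast K one' i = 1 := fun i hi =>
    if_pos ((hzero _).2 hi)
  have h1p : ∀ i : Fin (K - 1), i.val < m → 0 < dropLast K one' i := fun i hi => by
    rw [h1b i hi]; exact one_pos
  have hab : ∀ i : Fin (K - 1), i.val < m → 0 < dropLast K α i := fun i _ => hα _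
  simp only [boundaryPhase_add] at cGL cGG cLL
  rw [laplaceLimit_boundaryPhase (lam := dropLast K lam + dropLast K one') hab
    (fun i hi => add_pos (hlb i hi) (h1p i hi)) _ (pdQ.add pdR)] at cGL
  rw [laplaceLimit_boundaryPhase (lam := dropLast K lam + dropLast K lam) hab
    (fun i hi => add_pos (hlb i hi) (hlb i hi)) _ (pdQ.add pdQ)] at cGG
  rw [laplaceLimit_boundaryPhase (lam := dropLast K one' + dropLast K one') hab
    (fun i hi => add_pos (h1p i hi) (h1p i hi)) _ (pdR.add pdR)] at cLL
  set gGL := ∏ i, if i.val < m then (1 / (dropLast K lam + dropLast K one') i) ^ dropLast K α i *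
    Real.Gamma (dropLast K α i) else 1 with hgGL
  set gGG := ∏ i, if i.val < m then (1 / (dropLast K lam + dropLast K lam) i) ^ dropLast K α i *
    Real.Gamma (dropLast K α i) else 1 with hgGG
  set gLL := ∏ i, if i.val < m then (1 / (dropLast K one' + dropLast K one') i) ^ dropLast K α i *
    Real.Gamma (dropLast K α i) else 1 with hgLL
  set κ := regularDensity m α θs with hκ
  have hκ0 : 0 < κ := regularDensity_pos hK hα fun i hi =>
    lt_of_le_of_ne (hθ.1 i) fun h => hi ((hzero i).1 h.symm)
  set γ := Real.sqrt (2 * Real.pi) ^ Fintype.card (Fin (K - 1 - m)) with hγ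
  have hγ0 : 0 < γ := pow_pos (Real.sqrt_pos.2 (by positivity)) _
  have hgpos : ∀ l : Fin (K - 1) → ℝ, (∀ i, i.val < m → 0 < l i) →
      0 < ∏ i, if i.val < m then (1 / (l i)) ^ dropLast K α i *
        Real.Gamma (dropLast K α i) else 1 := fun l hl => Finset.prod_pos fun i _ => by
    split_ifs with hi
    · exact mul_pos (Real.rpow_pos_of_pos (one_div_pos.2 (hl i hi)) _)
        (Real.Gamma_pos_of_pos (hab i hi))
    · exact one_pos
  have hgGG0 : 0 < gGG := hgpos _ fun i hi => add_pos (hlb i hi) (hlb i hi)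
  have hgLL0 : 0 < gLL := hgpos _ fun i hi => add_pos (h1p i hi) (h1p i hi)
  have hdQ := Real.sqrt_pos.2 (pdQ.add pdQ).det_pos
  have hdR := Real.sqrt_pos.2 (pdR.add pdR).det_pos
  have hlim := (cGL.pow 2).div (cGG.mul cLL) (by positivity)
  -- evaluation of the limit
  have hprod : gGL ^ 2 / (gGG * gLL) =
      ∏ k : Fin K with k.val < m, (4 * lam k / (lam k + 1) ^ 2) ^ α k := by
    -- The target product runs over all `K` coordinates, the Laplace limits over `K - 1`; the last
    -- index is at least `m` and contributes the factor $1$.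
    rw [Finset.prod_filter, prod_eq_prod_dropLast_mul hK, if_neg (by simp; omega), mul_one, hgGL,
      hgGG, hgLL, ← Finset.prod_mul_distrib, ← Finset.prod_pow, ← Finset.prod_div_distrib]
    refine Finset.prod_congr rfl fun i _ => ?_
    simp only [dropLast]
    split_ifs with hi
    · have e := gamma_factor_ratio (hab i hi) (hlb i hi)
      have h1 := h1b i hi
      simp only [Pi.add_apply, h1]
      exact e
    · simp
  have hdet := det_factor_ratio pdQ pdR
  rw [hM, hN, neg_neg, neg_neg, ← hM, ← hN] at hdet
  have hval : (κ * (gGL * ((Real.sqrt (M + N).det)⁻¹ * γ))) ^ 2 /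
      (κ * (gGG * ((Real.sqrt (M + M).det)⁻¹ * γ)) *
        (κ * (gLL * ((Real.sqrt (N + N).det)⁻¹ * γ)))) =
      Real.sqrt |(reducedQ m H θs).det| * Real.sqrt |(reducedR m θs).det| /
        |((1 / 2 : ℝ) • (reducedQ m H θs + reducedR m θs)).det| *
          ∏ k : Fin K with k.val < m, (4 * lam k / (lam k + 1) ^ 2) ^ α k := by
    rw [← hprod, ← hdet]
    field_simp
  rw [hval] at hlim
  refine hlim.congr' ?_
  filter_upwards [eventually_gt_atTop 0] with n hn
  have hn0 : n ^ τ ≠ 0 := (Real.rpow_pos_of_pos hn τ).ne'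
  have hrho : rhoCV α H θs n =
      correlation (fun x => G x ^ n) (fun x => klFactor θs x ^ n) (dirichletMeasure α) := by
    unfold rhoCV
    rw [← correlation_const_mul (X := fun x => G x ^ n) (Y := fun x => klFactor θs x ^ n)
      (Real.exp_pos (n * H θs)) (Real.exp_pos (n * H θs))]
    refine correlation_congr (ae_of_all _ fun x => ?_) ?_
    · simp only [target, G, ← Real.exp_mul, ← Real.exp_add]
      congr 1
      ring
    · filter_upwards [ae_dirichletMeasure_mem_stdSimplex hK α] with x hx
      exact controlVariate_eq hθ.1 hx.1 hn
  rw [hrho, correlation_sq (integrable_rpow_dirichletMeasure hK hα hGc hn).aemeasurable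
    (integrable_rpow_dirichletMeasure hK hα hLc hn).aemeasurable]
  simp only [← hτ, Pi.div_apply]
  -- Numerator and denominator carry the same power $n^{2\tau}$, so normalizing the covariances does
  -- not change the quotient.
  rw [mul_pow, mul_mul_mul_comm, ← sq, mul_div_mul_left _ _ (pow_ne_zero 2 hn0)]
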